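/- Let $N\in\mathbb N$, $p>1$, $m,\alpha_1\in\mathbb R$ and $\alpha_2<2$. On the half-space $\mathbb R^{N+1}_+=\{(x,y):x\in\mathbb R^N,\ y>0\}$ write $L^p_m=L^p(\mathbb R^{N+1}_+;\,y^m\,dx\,dy)$ (real- or complex-valued functions), and let $W^{2,p}_{\mathcal N}(\alpha_1,\alpha_2,m)$ be the space of all $u\in W^{2,p}_{loc}(\mathbb R^{N+1}_+)$ such that $$u,\quad y^{\alpha_1}D_{x_ix_j}u,\quad y^{\alpha_1/2}D_{x_i}u,\quad y^{\alpha_2}D_{yy}u,\quad y^{\alpha_2/2}D_yu,\quad y^{\alpha_2-1}D_yu\ \in L^p_m\qquad(1\le i,j\le N),$$ with norm $$\|u\|_{L^p_m}+\sum_{i,j=1}^N\|y^{\alpha_1}D_{x_ix_j}u\|_{L^p_m}+\sum_{i=1}^N\|y^{\alpha_1/2}D_{x_i}u\|_{L^p_m}+\|y^{\alpha_2}D_{yy}u\|_{L^p_m}+\|y^{\alpha_2/2}D_yu\|_{L^p_m}+\|y^{\alpha_2-1}D_yu\|_{L^p_m}.$$ Let $\mathcal D$ be the set of all $v\in C_c^\infty([0,\infty))$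 for which there is $\delta>0$ with $v'(y)=0$ for $0\le y\le\delta$, and let $C_c^\infty(\mathbb R^N)\otimes\mathcal D$ be the set of all finite sums $\sum_i u_i(x)v_i(y)$ with $u_i\in C_c^\infty(\mathbb R^N)$ and $v_i\in\mathcal D$. If $\frac{m+1}{p}>\alpha_1^-:=\max(-\alpha_1,0)$, then $C_c^\infty(\mathbb R^N)\otimes\mathcal D$ is contained and dense in $W^{2,p}_{\mathcal N}(\alpha_1,\alpha_2,m)$. -/

import Mathlib

open MeasureTheory Set
open scoped ContDiff ENNReal

noncomputable section

namespace AnisoSobolev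

/-- Points `z = (x, y)` of `ℝ^N × ℝ`. -/
abbrev Pt (N : ℕ) : Type := EuclideanSpace ℝ (Fin N) × ℝ

/-- The open half-space `{(x, y) : x ∈ ℝ^N, y > 0}`. -/
def halfSpace (N : ℕ) : Set (Pt N) := {z | 0 < z.2}

/-- The measure `y^m dx dy` on the half-space. -/
def weightedMeasure (N : ℕ) (m : ℝ) : Measure (Pt N) :=
  (volume.restrict (halfSpace N)).withDensity fun z => ENNReal.ofReal (z.2 ^ m)

/-- The coordinate directions: `inl i` is `x_i`, `inr ()` is `y`. -/
def coordVec {N : ℕ} : Fin N ⊕ Unit → Pt N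
  | Sum.inl i => (EuclideanSpace.single i 1, 0)
  | Sum.inr _ => (0, 1)

section
variable {N : ℕ} {𝕜 : Type*} [RCLike 𝕜]

/-- `u ∈ L^p_loc` of the open half-space. -/
def MemLpLoc (p : ℝ) (u : Pt N → 𝕜) : Prop :=
  ∀ K : Set (Pt N), IsCompact K → K ⊆ halfSpace N →
    MemLp u (ENNReal.ofReal p) (volume.restrict K)

/-- `g` is the weak (distributional) derivative of `u` in the `k`-th coordinate direction on the
open half-space, both functions being locally integrable there. -/
def IsWeakDeriv (k : Fin N ⊕ Unit) (u g : Pt N → 𝕜) : Prop :=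
  LocallyIntegrableOn u (halfSpace N) ∧ LocallyIntegrableOn g (halfSpace N) ∧
    ∀ φ : Pt N → ℝ, ContDiff ℝ ∞ φ → HasCompactSupport φ → tsupport φ ⊆ halfSpace N →
      ∫ z in halfSpace N, (fderiv ℝ φ z (coordVec k)) • u z =
        -∫ z in halfSpace N, φ z • g z

/-- `u` has a weak derivative in the `k`-th coordinate direction. -/
def HasWeakDeriv (k : Fin N ⊕ Unit) (u : Pt N → 𝕜) : Prop := ∃ g, IsWeakDeriv k u g

open Classical in
/-- The weak derivative of `u` in the `k`-th coordinate direction; it is unique up to equality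
almost everywhere on the half-space (see `IsWeakDeriv.ae_eq`). The value `0` when there is none is
never used below. -/
def weakDeriv (k : Fin N ⊕ Unit) (u : Pt N → 𝕜) : Pt N → 𝕜 :=
  if h : HasWeakDeriv k u then h.choose else 0

/-- `u ∈ W^{2,p}_loc` of the open half-space: `u` and all its weak derivatives of order at most two
(the mixed ones included) exist and are in `L^p_loc`. -/
def MemW2pLoc (p : ℝ) (u : Pt N → 𝕜) : Prop :=
  MemLpLoc p u ∧
  ∀ k : Fin N ⊕ Unit, HasWeakDeriv k u ∧ MemLpLoc p (weakDeriv k u) ∧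
    ∀ l : Fin N ⊕ Unit, HasWeakDeriv l (weakDeriv k u) ∧ MemLpLoc p (weakDeriv l (weakDeriv k u))

/-- `D_{x_i} u` -/
def Dx (i : Fin N) (u : Pt N → 𝕜) : Pt N → 𝕜 := weakDeriv (Sum.inl i) u

/-- `D_{x_i x_j} u` -/
def Dxx (i j : Fin N) (u : Pt N → 𝕜) : Pt N → 𝕜 := Dx i (Dx j u)

/-- `D_y u` -/
def Dy (u : Pt N → 𝕜) : Pt N → 𝕜 := weakDeriv (Sum.inr ()) u

/-- `D_{yy} u` -/
def Dyy (u : Pt N → 𝕜) : Pt N → 𝕜 := Dy (Dy u)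

/-- The function `y^a g`. -/
def yPow (a : ℝ) (g : Pt N → 𝕜) : Pt N → 𝕜 := fun z => (z.2 ^ a) • g z

/-- `u ∈ L^p_m`. -/
def MemLpm (p m : ℝ) (u : Pt N → 𝕜) : Prop := MemLp u (ENNReal.ofReal p) (weightedMeasure N m)

/-- The norm of `L^p_m`. -/
def normLpm (p m : ℝ) (u : Pt N → 𝕜) : ℝ≥0∞ :=
  eLpNorm u (ENNReal.ofReal p) (weightedMeasure N m)

/-- `u ∈ W^{2,p}(α₁, α₂, m)`. -/
def MemW (p α₁ α₂ m : ℝ) (u : Pt N → 𝕜) : Prop :=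
  MemW2pLoc p u ∧ MemLpm p m u ∧
    (∀ i j : Fin N, MemLpm p m (yPow α₁ (Dxx i j u))) ∧
    (∀ i : Fin N, MemLpm p m (yPow (α₁ / 2) (Dx i u))) ∧
    MemLpm p m (yPow α₂ (Dyy u)) ∧ MemLpm p m (yPow (α₂ / 2) (Dy u))

/-- The norm of `W^{2,p}(α₁, α₂, m)`. -/
def normW (p α₁ α₂ m : ℝ) (u : Pt N → 𝕜) : ℝ≥0∞ :=
  normLpm p m u + (∑ i : Fin N, ∑ j : Fin N, normLpm p m (yPow α₁ (Dxx i j u))) +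
    (∑ i : Fin N, normLpm p m (yPow (α₁ / 2) (Dx i u))) +
    normLpm p m (yPow α₂ (Dyy u)) + normLpm p m (yPow (α₂ / 2) (Dy u))

/-- `u ∈ W^{2,p}_𝒩(α₁, α₂, m)`. -/
def MemWN (p α₁ α₂ m : ℝ) (u : Pt N → 𝕜) : Prop :=
  MemW p α₁ α₂ m u ∧ MemLpm p m (yPow (α₂ - 1) (Dy u))

/-- The norm of `W^{2,p}_𝒩(α₁, α₂, m)`. -/
def normWN (p α₁ α₂ m : ℝ) (u : Pt N → 𝕜) : ℝ≥0∞ :=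
  normW p α₁ α₂ m u + normLpm p m (yPow (α₂ - 1) (Dy u))

/-- The set `𝒟` of the `v ∈ C_c^∞([0, ∞))` with `v' = 0` on `[0, δ]` for some `δ > 0`. (Only the
values on `[0, ∞)` matter.) -/
def MemD (v : ℝ → 𝕜) : Prop :=
  ContDiffOn ℝ ∞ v (Ici 0) ∧ (∃ R : ℝ, ∀ y, R ≤ y → v y = 0) ∧
    ∃ δ : ℝ, 0 < δ ∧ ∀ y ∈ Icc 0 δ, derivWithin v (Ici 0) y = 0

variable (N 𝕜) in
/-- `C_c^∞(ℝ^N) ⊗ 𝒟`: the finite sums `∑ u_i(x) v_i(y)` with `u_i ∈ C_c^∞(ℝ^N)`, `v_i ∈ 𝒟`. -/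
def tensorCcD : Set (Pt N → 𝕜) :=
  {w | ∃ (n : ℕ) (f : Fin n → EuclideanSpace ℝ (Fin N) → 𝕜) (g : Fin n → ℝ → 𝕜),
    (∀ i, ContDiff ℝ ∞ (f i) ∧ HasCompactSupport (f i)) ∧ (∀ i, MemD (g i)) ∧
    w = fun z => ∑ i, f i z.1 * g i z.2}

lemma isOpen_halfSpace : IsOpen (halfSpace N) := isOpen_lt continuous_const continuous_snd

/-- Weak derivatives are unique almost everywhere on the half-space. -/
lemma IsWeakDeriv.ae_eq {k : Fin N ⊕ Unit} {u g h : Pt N → 𝕜}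
    (hg : IsWeakDeriv k u g) (hh : IsWeakDeriv k u h) :
    g =ᵐ[volume.restrict (halfSpace N)] h := by
  have key : ∀ᵐ z : Pt N, z ∈ halfSpace N → (g - h) z = 0 := by
    refine isOpen_halfSpace.ae_eq_zero_of_integral_contDiff_smul_eq_zero (hg.2.1.sub hh.2.1) ?_
    intro φ hφ hc hs
    have hint : ∀ f : Pt N → 𝕜, LocallyIntegrableOn f (halfSpace N) →
        IntegrableOn (fun z => φ z • f z) (halfSpace N) := fun f hf => by
      have h1 : IntegrableOn (fun z => φ z • f z) (tsupport φ) :=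
        (hf.integrableOn_compact_subset hs hc).continuousOn_smul hφ.continuous.continuousOn hc
      refine IntegrableOn.mono_set (t := univ) ?_ (subset_univ _)
      rw [integrableOn_univ]
      refine (integrableOn_iff_integrable_of_support_subset fun z hz => ?_).1 h1
      by_contra h2
      exact hz (by simp [image_eq_zero_of_notMem_tsupport h2])
    have e : ∫ z in halfSpace N, φ z • (g - h) z = ∫ z, φ z • (g - h) z := by
      refine setIntegral_eq_integral_of_forall_compl_eq_zero fun z hz => ?_
      rw [image_eq_zero_of_notMem_tsupport (fun hz' => hz (hs hz')), zero_smul]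
    rw [← e]
    simp only [Pi.sub_apply, smul_sub]
    rw [integral_sub (hint g hg.2.1) (hint h hh.2.1)]
    have h1 := hg.2.2 φ hφ hc hs
    have h2 := hh.2.2 φ hφ hc hs
    rw [h1, neg_inj] at h2
    rw [h2, sub_self]
  refine (ae_restrict_iff' isOpen_halfSpace.measurableSet).2 ?_
  filter_upwards [key] with z hz hz'
  exact sub_eq_zero.1 (hz hz')

lemma HasWeakDeriv.isWeakDeriv {k : Fin N ⊕ Unit} {u : Pt N → 𝕜} (h : HasWeakDeriv k u) :
    IsWeakDeriv k u (weakDeriv k u) := by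
  rw [weakDeriv, dif_pos h]
  exact h.choose_spec

end

end AnisoSobolev

end

/-!
The approximation is built in two stages. Write `wₘ(x)` for the mean of `w(x, ·)` over `[1/r, 2/r]`
and let `φ` be a smooth cutoff, `φ = 1` on `(-∞, 1]` and `φ = 0` on `[2, ∞)`. For large `r` the
function `u` is replaced by

  `(φ(y/r) - φ(ry)) w(x, y) + φ(ry) wₘ(x)`,

where `w` approximates `u` on the strip `1/r ≤ y ≤ 2r` only. This function vanishes for `y ≥ 2r` and
does not depend on `y` for `y ≤ 1/r`; if `w = ∑ f_i(x) g_i(y)` is a tensor product, so is the new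
function, and it belongs to `C_c^∞(ℝ^N) ⊗ 𝒟`.

On the strip all weights are bounded above and below, so that `w` only has to be close to `u` in the
unweighted `W^{2,p}` norm there, with errors that may be chosen after `r`. Mollification with a
kernel of product form commutes with weak derivatives, and the Riemann sums of the convolution
integral are tensor products (`exists_tensorSum_eLpNorm_le`).

It remains to see that the passage from `w` to the regularized function is harmless, uniformly in
`r`. All errors are controlled by `approxError`: the distance of the derivatives of `u` and `w` on
the strip, and the norm of the derivatives of `u` on `{y ≤ 2/r} ∪ {y ≥ r}`, which tends to `0`.

* For the tangential derivatives, `y^a |φ(ry) wₘ|` has `L^p_m` norm at most a constant times the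
  norm of `y^a w` on `1/r ≤ y ≤ 2/r`, provided that `y^{ap+m}` is integrable near `0`
  (`normLpm_yPow_le_of_mean`, `exists_normLpm_sub_regularized_le`). For `a = 0, α₁/2, α₁` this is
  the hypothesis `(m+1)/p > α₁⁻`.
* In the normal derivatives there appear `φ'(ry) r (w - wₘ)` and `φ''(ry) r² (w - wₘ)`. By the
  Poincaré inequality `|w - wₘ|` is at most the integral of `|D_y w|` over `[1/r, 2/r]`
  (`enorm_sub_mean_le`), and as `r` is comparable to `1/y` where `φ'(ry) ≠ 0`, these terms are
  controlled by `y^{α₂-1} D_y u`, which is where the Neumann condition enters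
  (`exists_normLpm_sub_regularized_deriv_le`, `exists_normLpm_sub_regularized_deriv_deriv_le`). The
  derivatives of `φ(y/r)` are harmless because `α₂ < 2`.
-/

noncomputable section

namespace AnisoSobolev

/-! ### Classical and weak derivatives -/

section Derivatives

variable {N : ℕ} {𝕜 : Type*} [RCLike 𝕜]

instance : (volume : Measure (Pt N)).IsAddHaarMeasure :=
  inferInstanceAs ((volume : Measure (EuclideanSpace ℝ (Fin N))).prod
    (volume : Measure ℝ)).IsAddHaarMeasure

section Classical
variable {F : Type*} [NormedAddCommGroup F] [NormedSpace ℝ F]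

/-- The classical partial derivative in the `k`-th coordinate direction. -/
def pderiv (k : Fin N ⊕ Unit) (φ : Pt N → F) : Pt N → F := fun z => fderiv ℝ φ z (coordVec k)

/-- The iterated classical partial derivative along a list of coordinate directions; the head of
the list is applied last. -/
def pderivs : List (Fin N ⊕ Unit) → (Pt N → F) → Pt N → F
  | [], φ => φ
  | k :: L, φ => pderiv k (pderivs L φ)

lemma contDiff_pderiv {φ : Pt N → F} (h : ContDiff ℝ ∞ φ) (k : Fin N ⊕ Unit) :
    ContDiff ℝ ∞ (pderiv k φ) :=
  (h.fderiv_right (m := ∞) (by simp)).clm_apply contDiff_const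

lemma contDiff_pderivs {φ : Pt N → F} (h : ContDiff ℝ ∞ φ) (L : List (Fin N ⊕ Unit)) :
    ContDiff ℝ ∞ (pderivs L φ) := by
  induction L with
  | nil => exact h
  | cons k L ih => exact contDiff_pderiv ih k

lemma tsupport_pderiv_subset (φ : Pt N → F) (k : Fin N ⊕ Unit) :
    tsupport (pderiv k φ) ⊆ tsupport φ := by
  refine closure_minimal (fun z hz => ?_) (isClosed_tsupport φ)
  by_contra h
  exact hz (by simp [pderiv, fderiv_of_notMem_tsupport (𝕜 := ℝ) h])

lemma tsupport_pderivs_subset (φ : Pt N → F) (L : List (Fin N ⊕ Unit)) :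
    tsupport (pderivs L φ) ⊆ tsupport φ := by
  induction L with
  | nil => exact subset_rfl
  | cons k L ih => exact (tsupport_pderiv_subset _ k).trans ih

lemma pderiv_comm {φ : Pt N → F} (h : ContDiff ℝ ∞ φ) (k l : Fin N ⊕ Unit) :
    pderiv k (pderiv l φ) = pderiv l (pderiv k φ) := by
  funext z
  have hs : IsSymmSndFDerivAt ℝ φ z :=
    h.contDiffAt.isSymmSndFDerivAt (by
      rw [minSmoothness_of_isRCLikeNormedField]; exact WithTop.coe_le_coe.2 (le_top : (2 : ℕ∞) ≤ ⊤))
  have hd : DifferentiableAt ℝ (fderiv ℝ φ) z :=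
    (h.fderiv_right (m := ∞) (by simp)).differentiable (by simp) z
  have e : ∀ v w : Pt N, fderiv ℝ (fun z => fderiv ℝ φ z v) z w = fderiv ℝ (fderiv ℝ φ) z w v := by
    intro v w
    rw [fderiv_clm_apply hd (differentiableAt_const v)]
    simp
  change fderiv ℝ (fun z => fderiv ℝ φ z (coordVec l)) z (coordVec k) =
    fderiv ℝ (fun z => fderiv ℝ φ z (coordVec k)) z (coordVec l)
  rw [e, e, hs.eq]

end Classical

lemma IsWeakDeriv.congr {k : Fin N ⊕ Unit} {u v g h : Pt N → 𝕜} (H : IsWeakDeriv k u g)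
    (huv : u =ᵐ[volume.restrict (halfSpace N)] v) (hgh : g =ᵐ[volume.restrict (halfSpace N)] h) :
    IsWeakDeriv k v h := by
  have key : ∀ {a b : Pt N → 𝕜}, LocallyIntegrableOn a (halfSpace N) →
      a =ᵐ[volume.restrict (halfSpace N)] b → LocallyIntegrableOn b (halfSpace N) := by
    intro a b ha hab
    rw [locallyIntegrableOn_iff isOpen_halfSpace.isLocallyClosed] at ha ⊢
    intro K hK hc
    exact (ha K hK hc).congr_fun_ae (ae_restrict_of_ae_restrict_of_subset hK hab)
  refine ⟨key H.1 huv, key H.2.1 hgh, fun φ hφ hc hs => ?_⟩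
  have e := H.2.2 φ hφ hc hs
  have e1 : ∫ z in halfSpace N, (fderiv ℝ φ z (coordVec k)) • v z =
      ∫ z in halfSpace N, (fderiv ℝ φ z (coordVec k)) • u z :=
    integral_congr_ae (by filter_upwards [huv] with z hz using by simp [hz])
  have e2 : ∫ z in halfSpace N, φ z • h z = ∫ z in halfSpace N, φ z • g z :=
    integral_congr_ae (by filter_upwards [hgh] with z hz using by simp [hz])
  rw [e1, e2, e]

lemma integrable_smul_of_locallyIntegrableOn {φ : Pt N → ℝ} (hφ : Continuous φ)
    (hc : HasCompactSupport φ) (hs : tsupport φ ⊆ halfSpace N) {f : Pt N → 𝕜}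
    (hf : LocallyIntegrableOn f (halfSpace N)) : Integrable (fun z => φ z • f z) := by
  have h1 : IntegrableOn (fun z => φ z • f z) (tsupport φ) :=
    (hf.integrableOn_compact_subset hs hc).continuousOn_smul hφ.continuousOn hc
  refine (integrableOn_iff_integrable_of_support_subset fun z hz => ?_).1 h1
  by_contra h2
  exact hz (by simp [image_eq_zero_of_notMem_tsupport h2])

lemma hasCompactSupport_pderiv {F : Type*} [NormedAddCommGroup F] [NormedSpace ℝ F]
    {φ : Pt N → F} (h : HasCompactSupport φ) (k : Fin N ⊕ Unit) :
    HasCompactSupport (pderiv k φ) := by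
  refine h.of_isClosed_subset (isClosed_tsupport _) (tsupport_pderiv_subset φ k)

lemma hasCompactSupport_pderivs {F : Type*} [NormedAddCommGroup F] [NormedSpace ℝ F]
    {φ : Pt N → F} (h : HasCompactSupport φ) (L : List (Fin N ⊕ Unit)) :
    HasCompactSupport (pderivs L φ) := by
  refine h.of_isClosed_subset (isClosed_tsupport _) (tsupport_pderivs_subset φ L)

lemma IsWeakDeriv.sub {k : Fin N ⊕ Unit} {u v g h : Pt N → 𝕜} (hu : IsWeakDeriv k u g)
    (hv : IsWeakDeriv k v h) : IsWeakDeriv k (u - v) (g - h) := by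
  refine ⟨hu.1.sub hv.1, hu.2.1.sub hv.2.1, fun φ hφ hc hs => ?_⟩
  have hφ' : Continuous (pderiv k φ) := (contDiff_pderiv hφ k).continuous
  have hc' := hasCompactSupport_pderiv hc k
  have hs' := (tsupport_pderiv_subset φ k).trans hs
  simp only [Pi.sub_apply, smul_sub]
  rw [integral_sub, integral_sub, hu.2.2 φ hφ hc hs, hv.2.2 φ hφ hc hs]
  · ring
  · exact (integrable_smul_of_locallyIntegrableOn hφ.continuous hc hs hu.2.1).integrableOn
  · exact (integrable_smul_of_locallyIntegrableOn hφ.continuous hc hs hv.2.1).integrableOn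
  · exact (integrable_smul_of_locallyIntegrableOn hφ' hc' hs' hu.1).integrableOn
  · exact (integrable_smul_of_locallyIntegrableOn hφ' hc' hs' hv.1).integrableOn

/-- The classical derivative of a smooth function is a weak derivative. -/
lemma isWeakDeriv_pderiv {w : Pt N → 𝕜} (hw : ContDiff ℝ ∞ w) (k : Fin N ⊕ Unit) :
    IsWeakDeriv k w (pderiv k w) := by
  have hw' := (contDiff_pderiv hw k).continuous
  have hl : LocallyIntegrableOn w (halfSpace N) := hw.continuous.locallyIntegrable.locallyIntegrableOn _
  have hl' : LocallyIntegrableOn (pderiv k w) (halfSpace N) :=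
    hw'.locallyIntegrable.locallyIntegrableOn _
  refine ⟨hl, hl', fun φ hφ hc hs => ?_⟩
  have hφ' : Continuous (pderiv k φ) := (contDiff_pderiv hφ k).continuous
  have hc' := hasCompactSupport_pderiv hc k
  have hs' := (tsupport_pderiv_subset φ k).trans hs
  rw [setIntegral_eq_integral_of_forall_compl_eq_zero, setIntegral_eq_integral_of_forall_compl_eq_zero]
  · have := integral_smul_fderiv_eq_neg_fderiv_smul_of_integrable (μ := (volume : Measure (Pt N)))
      (f := φ) (g := w) (v := coordVec k)
      (integrable_smul_of_locallyIntegrableOn hφ' hc' hs' hl)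
      (integrable_smul_of_locallyIntegrableOn hφ.continuous hc hs hl')
      (integrable_smul_of_locallyIntegrableOn hφ.continuous hc hs hl)
      (fun x _ => hφ.differentiable (by simp) x) (fun x _ => hw.differentiable (by simp) x)
    simp only [pderiv]
    rw [this, neg_neg]
  · intro z hz
    rw [image_eq_zero_of_notMem_tsupport (fun h => hz (hs h)), zero_smul]
  · intro z hz
    have : pderiv k φ z = 0 := image_eq_zero_of_notMem_tsupport (fun h => hz (hs' h))
    simp only [pderiv] at this
    rw [this, zero_smul]

lemma IsWeakDeriv.weakDeriv_ae_eq {k : Fin N ⊕ Unit} {u g : Pt N → 𝕜} (h : IsWeakDeriv k u g) :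
    weakDeriv k u =ᵐ[volume.restrict (halfSpace N)] g :=
  (HasWeakDeriv.isWeakDeriv ⟨g, h⟩).ae_eq h

/-- `G` is the weak derivative of `u` along the list `L` of coordinate directions: the iterated
partial derivative, tested against smooth functions compactly supported in the half-space. -/
def IsWeakDerivs (L : List (Fin N ⊕ Unit)) (u G : Pt N → 𝕜) : Prop :=
  ∀ φ : Pt N → ℝ, ContDiff ℝ ∞ φ → HasCompactSupport φ → tsupport φ ⊆ halfSpace N →
      ∫ z in halfSpace N, (pderivs L φ z) • u z = (-1 : ℝ) ^ L.length • ∫ z in halfSpace N, φ z • G z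

lemma isWeakDerivs_nil (u : Pt N → 𝕜) : IsWeakDerivs [] u u := by
  intro φ _ _ _
  simp [pderivs]

lemma IsWeakDeriv.isWeakDerivs {k : Fin N ⊕ Unit} {u g : Pt N → 𝕜} (h : IsWeakDeriv k u g) :
    IsWeakDerivs [k] u g := by
  intro φ hφ hc hs
  simpa [pderivs, pderiv] using h.2.2 φ hφ hc hs

lemma IsWeakDeriv.isWeakDerivs_cons {k l : Fin N ⊕ Unit} {u g h : Pt N → 𝕜}
    (hg : IsWeakDeriv k u g) (hh : IsWeakDeriv l g h) : IsWeakDerivs [l, k] u h := by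
  intro φ hφ hc hs
  have h1 := hg.2.2 (pderiv l φ) (contDiff_pderiv hφ l) (hasCompactSupport_pderiv hc l)
    ((tsupport_pderiv_subset φ l).trans hs)
  have h2 := hh.2.2 φ hφ hc hs
  have e : pderivs [l, k] φ = pderiv k (pderiv l φ) := pderiv_comm hφ l k
  rw [e]
  simp only [pderiv] at h1 ⊢
  rw [h1, h2]
  simp

lemma weightedMeasure_absolutelyContinuous (m : ℝ) :
    weightedMeasure N m ≪ volume.restrict (halfSpace N) :=
  withDensity_absolutelyContinuous _ _

lemma weakDeriv_sub_ae_eq {u v w : Pt N → 𝕜} (hw : ContDiff ℝ ∞ w)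
    (hv : v =ᵐ[volume.restrict (halfSpace N)] w)
    {k : Fin N ⊕ Unit} (hk : HasWeakDeriv k u) :
    weakDeriv k (u - v) =ᵐ[volume.restrict (halfSpace N)] weakDeriv k u - pderiv k w :=
  (hk.isWeakDeriv.sub ((isWeakDeriv_pderiv hw k).congr hv.symm .rfl)).weakDeriv_ae_eq

lemma weakDeriv_weakDeriv_sub_ae_eq {u v w : Pt N → 𝕜} (hw : ContDiff ℝ ∞ w)
    (hv : v =ᵐ[volume.restrict (halfSpace N)] w)
    {k l : Fin N ⊕ Unit} (hk : HasWeakDeriv k u) (hl : HasWeakDeriv l (weakDeriv k u)) :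
    weakDeriv l (weakDeriv k (u - v)) =ᵐ[volume.restrict (halfSpace N)]
      weakDeriv l (weakDeriv k u) - pderivs [l, k] w := by
  have h := hl.isWeakDeriv.sub (isWeakDeriv_pderiv (contDiff_pderiv hw k) l)
  exact (h.congr (weakDeriv_sub_ae_eq hw hv hk).symm .rfl).weakDeriv_ae_eq

end Derivatives

/-! ### Integral inequalities in `L^p` -/

section Lp
open Filter Topology

variable {α β : Type*} [MeasurableSpace α] [MeasurableSpace β] {E : Type*} [NormedAddCommGroup E]

lemma eLpNorm_ofReal_rpow {p : ℝ} (hp : 0 < p) (f : α → E) (μ : Measure α) :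
    eLpNorm f (ENNReal.ofReal p) μ ^ p = ∫⁻ x, ‖f x‖ₑ ^ p ∂μ := by
  rw [eLpNorm_eq_lintegral_rpow_enorm_toReal (by simpa using hp) ENNReal.ofReal_ne_top,
    ENNReal.toReal_ofReal hp.le, ← ENNReal.rpow_mul, one_div_mul_cancel hp.ne', ENNReal.rpow_one]

lemma eLpNorm_ofReal_le_iff {p : ℝ} (hp : 0 < p) {f : α → E} {μ : Measure α} {C : ℝ≥0∞} :
    eLpNorm f (ENNReal.ofReal p) μ ≤ C ↔ ∫⁻ x, ‖f x‖ₑ ^ p ∂μ ≤ C ^ p := by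
  rw [← eLpNorm_ofReal_rpow hp, ENNReal.rpow_le_rpow_iff hp]

/-- Jensen's inequality for the power `p`, without normalization of the measure. -/
lemma rpow_lintegral_le {ν : Measure β} {p : ℝ} (hp : 1 < p) {f : β → ℝ≥0∞}
    (hf : AEMeasurable f ν) :
    (∫⁻ t, f t ∂ν) ^ p ≤ ν univ ^ (p - 1) * ∫⁻ t, f t ^ p ∂ν := by
  have hpq := Real.HolderConjugate.conjExponent hp
  have hp0 : 0 < p := by linarith
  have h := ENNReal.lintegral_mul_le_Lp_mul_Lq ν hpq hf (aemeasurable_const (b := (1 : ℝ≥0∞)))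
  simp only [Pi.mul_apply, mul_one, ENNReal.one_rpow, lintegral_one] at h
  calc (∫⁻ t, f t ∂ν) ^ p
      ≤ ((∫⁻ t, f t ^ p ∂ν) ^ (1 / p) * ν univ ^ (1 / p.conjExponent)) ^ p := by gcongr
    _ = ν univ ^ (p - 1) * ∫⁻ t, f t ^ p ∂ν := by
      rw [ENNReal.mul_rpow_of_nonneg _ _ hp0.le, ← ENNReal.rpow_mul, ← ENNReal.rpow_mul,
        one_div_mul_cancel hp0.ne', ENNReal.rpow_one, mul_comm]
      congr 2
      rw [Real.conjExponent]
      field_simp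

/-- Jensen's inequality under the integral sign. -/
lemma lintegral_rpow_lintegral_le {μ : Measure α} {ν : Measure β} [SFinite μ] [SFinite ν]
    {p : ℝ} (hp : 1 < p) {h : α → β → ℝ≥0∞} (hh : AEMeasurable (Function.uncurry h) (μ.prod ν)) :
    ∫⁻ x, (∫⁻ t, h x t ∂ν) ^ p ∂μ ≤ ν univ ^ (p - 1) * ∫⁻ t, ∫⁻ x, h x t ^ p ∂μ ∂ν := by
  have hx : ∀ᵐ x ∂μ, AEMeasurable (h x) ν := by
    filter_upwards [hh.aestronglyMeasurable.prodMk_left] with x hx using hx.aemeasurable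
  calc ∫⁻ x, (∫⁻ t, h x t ∂ν) ^ p ∂μ
      ≤ ∫⁻ x, ν univ ^ (p - 1) * ∫⁻ t, h x t ^ p ∂ν ∂μ := by
        refine lintegral_mono_ae ?_
        filter_upwards [hx] with x hx using rpow_lintegral_le hp hx
    _ = ν univ ^ (p - 1) * ∫⁻ x, ∫⁻ t, h x t ^ p ∂ν ∂μ :=
        lintegral_const_mul'' _ (hh.pow_const p).lintegral_prod_right'
    _ = _ := by
        rw [lintegral_lintegral_swap (hh.pow_const p)]

/-- Minkowski's integral inequality for a weighted superposition of functions of bounded norm. -/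
lemma eLpNorm_integral_smul_le {𝕜 : Type*} [RCLike 𝕜] {μ : Measure α} {ν : Measure β}
    [SFinite μ] [SFinite ν] {p : ℝ} (hp : 1 < p) {κ : β → ℝ} (hκ : Measurable κ)
    (hκi : Integrable κ ν) {f : α → β → 𝕜}
    (hf : AEStronglyMeasurable (Function.uncurry f) (μ.prod ν)) {B : ℝ≥0∞}
    (hB : ∀ t, κ t ≠ 0 → eLpNorm (fun z => f z t) (ENNReal.ofReal p) μ ≤ B) :
    eLpNorm (fun z => ∫ t, κ t • f z t ∂ν) (ENNReal.ofReal p) μ ≤ (∫⁻ t, ‖κ t‖ₑ ∂ν) * B := by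
  have hp0 : 0 < p := by linarith
  set c := ∫⁻ t, ‖κ t‖ₑ ∂ν with hc
  have hcf : c ≠ ⊤ := hκi.2.ne
  set ν' := ν.withDensity (fun t => ‖κ t‖ₑ) with hν'
  have hν'u : ν' univ = c := by rw [hν', withDensity_apply _ MeasurableSet.univ, Measure.restrict_univ]
  have hfin : IsFiniteMeasure ν' := ⟨by rw [hν'u]; exact hcf.lt_top⟩
  have hac : μ.prod ν' ≪ μ.prod ν :=
    Measure.AbsolutelyContinuous.rfl.prod (withDensity_absolutelyContinuous _ _)
  have hm : AEMeasurable (Function.uncurry fun z t => ‖f z t‖ₑ) (μ.prod ν') :=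
    (hf.mono_ac hac).enorm
  have hae : ∀ᵐ t ∂ν', κ t ≠ 0 := by
    rw [hν', ae_withDensity_iff hκ.enorm]
    exact ae_of_all _ fun t ht => by simpa using ht
  rw [eLpNorm_ofReal_le_iff hp0]
  calc ∫⁻ z, ‖∫ t, κ t • f z t ∂ν‖ₑ ^ p ∂μ
      ≤ ∫⁻ z, (∫⁻ t, ‖f z t‖ₑ ∂ν') ^ p ∂μ := by
        refine lintegral_mono fun z => ?_
        gcongr
        refine (enorm_integral_le_lintegral_enorm _).trans ?_
        rw [hν', lintegral_withDensity_eq_lintegral_mul_non_measurable _ hκ.enorm (by simp)]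
        simp [enorm_smul]
    _ ≤ ν' univ ^ (p - 1) * ∫⁻ t, ∫⁻ z, ‖f z t‖ₑ ^ p ∂μ ∂ν' := lintegral_rpow_lintegral_le hp hm
    _ ≤ ν' univ ^ (p - 1) * ∫⁻ t, B ^ p ∂ν' := by
        refine mul_le_mul_right ?_ _
        refine lintegral_mono_ae ?_
        filter_upwards [hae] with t ht using (eLpNorm_ofReal_le_iff hp0).1 (hB t ht)
    _ = (c * B) ^ p := by
        rw [lintegral_const, hν'u, ENNReal.mul_rpow_of_nonneg _ _ hp0.le, mul_comm (B ^ p), ← mul_assoc]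
        congr 1
        by_cases h0 : c = 0
        · simp [h0, hp0]
        · nth_rewrite 2 [← ENNReal.rpow_one c]
          rw [← ENNReal.rpow_add _ _ h0 hcf]; congr 1; ring

/-- Dominated convergence in `L^p`. -/
lemma tendsto_eLpNorm_zero_of_dominated {μ : Measure α} {p : ℝ} (hp : 0 < p) {F : ℕ → α → E}
    (hF : ∀ n, AEStronglyMeasurable (F n) μ) {g : α → ℝ≥0∞} (hg : ∫⁻ x, g x ^ p ∂μ ≠ ⊤)
    (hb : ∀ n, ∀ᵐ x ∂μ, ‖F n x‖ₑ ≤ g x) (hl : ∀ᵐ x ∂μ, Tendsto (fun n => F n x) atTop (𝓝 0)) :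
    Tendsto (fun n => eLpNorm (F n) (ENNReal.ofReal p) μ) atTop (𝓝 0) := by
  have h : Tendsto (fun n => ∫⁻ x, ‖F n x‖ₑ ^ p ∂μ) atTop (𝓝 (∫⁻ _, 0 ∂μ)) := by
    refine tendsto_lintegral_of_dominated_convergence' _ (fun n => (hF n).enorm.pow_const p)
      (fun n => ?_) hg ?_
    · filter_upwards [hb n] with x hx
      gcongr
    · filter_upwards [hl] with x hx
      have := ((ENNReal.continuous_rpow_const (y := p)).tendsto _).comp hx.enorm
      simpa [hp, Function.comp_def] using this
  rw [lintegral_zero] at h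
  have h2 := ((ENNReal.continuous_rpow_const (y := 1 / p)).tendsto 0).comp h
  rw [ENNReal.zero_rpow_of_pos (by positivity)] at h2
  refine h2.congr fun n => ?_
  simp only [Function.comp]
  rw [← eLpNorm_ofReal_rpow hp, ← ENNReal.rpow_mul, mul_one_div_cancel hp.ne', ENNReal.rpow_one]

lemma tendsto_eLpNorm_indicator_zero {μ : Measure α} {p : ℝ} (hp : 0 < p) {f : α → E}
    (hf : MemLp f (ENNReal.ofReal p) μ) {S : ℕ → Set α} (hS : ∀ n, MeasurableSet (S n))
    (h : ∀ᵐ x ∂μ, ∀ᶠ n in atTop, x ∉ S n) :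
    Tendsto (fun n => eLpNorm ((S n).indicator f) (ENNReal.ofReal p) μ) atTop (𝓝 0) := by
  refine tendsto_eLpNorm_zero_of_dominated hp (fun n => hf.1.indicator (hS n))
    (g := fun x => ‖f x‖ₑ) ?_ (fun n => ae_of_all _ fun x => enorm_indicator_le_enorm_self _ _) ?_
  · rw [← eLpNorm_ofReal_rpow hp]
    exact ENNReal.rpow_ne_top_of_nonneg hp.le hf.2.ne
  · filter_upwards [h] with x hx
    refine tendsto_const_nhds.congr' ?_
    filter_upwards [hx] with n hn
    simp [hn]

end Lp

section Convolution
open Filter Topology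

variable {N : ℕ} {𝕜 : Type*} [RCLike 𝕜]

lemma aestronglyMeasurable_sub_comp {G : Pt N → 𝕜} (hG : AEStronglyMeasurable G volume) :
    AEStronglyMeasurable (Function.uncurry fun z t : Pt N => G (z - t)) (volume.prod volume) :=
  hG.comp_quasiMeasurePreserving (quasiMeasurePreserving_sub_of_right_invariant volume volume)

lemma eLpNorm_sub_translate_le {p : ℝ} (hp : 1 < p) {G : Pt N → 𝕜}
    (hG : MemLp G (ENNReal.ofReal p) volume) {ε : ℝ≥0∞} (hε : 0 < ε) :
    ∃ r : ℝ, 0 < r ∧ ∀ t : Pt N, ‖t‖ < r →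
      eLpNorm (fun z => G (z - t) - G z) (ENNReal.ofReal p) volume ≤ ε := by
  have : Fact (1 ≤ ENNReal.ofReal p) := ⟨by simpa using hp.le⟩
  let g : C(Pt N, C(Pt N, Pt N)) :=
    (ContinuousMap.mk (fun a : Pt N × Pt N => a.2 - a.1) (by fun_prop)).curry
  have hg : ∀ t, MeasurePreserving (g t) (volume : Measure (Pt N)) volume := fun t =>
    measurePreserving_sub_right volume t
  have hc : Continuous fun t => Lp.compMeasurePreserving (g t) (hg t) (hG.toLp G) :=
    continuous_const.compMeasurePreservingLp g.continuous hg ENNReal.ofReal_ne_top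
  have hcl := (EMetric.tendsto_nhds.1 (hc.tendsto 0)) ε hε
  obtain ⟨r, hr, hr'⟩ := Metric.eventually_nhds_iff.1 hcl
  refine ⟨r, hr, fun t ht => ?_⟩
  have h := (hr' (y := t) (by simpa using ht)).le
  rw [Lp.edist_def] at h
  refine le_of_eq_of_le (eLpNorm_congr_ae ?_) h
  have e1 := Lp.coeFn_compMeasurePreserving (hG.toLp G) (hg t)
  have e2 := Lp.coeFn_compMeasurePreserving (hG.toLp G) (hg 0)
  have e3 := hG.coeFn_toLp
  have e4 := (hg t).quasiMeasurePreserving.ae_eq_comp e3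
  have e5 := (hg 0).quasiMeasurePreserving.ae_eq_comp e3
  filter_upwards [e1, e2, e4, e5] with z h1 h2 h4 h5
  rw [Pi.sub_apply, h1, h2, h4, h5]
  simp [g]

/-- Young's inequality for the convolution with an integrable kernel. -/
lemma eLpNorm_convolution_le {p : ℝ} (hp : 1 < p) {K : Pt N → ℝ} (hK : Continuous K)
    (hc : HasCompactSupport K) {U : Pt N → 𝕜} (hU : AEStronglyMeasurable U volume) :
    eLpNorm (fun z => ∫ ξ, K (z - ξ) • U ξ) (ENNReal.ofReal p) volume ≤
      (∫⁻ t, ‖K t‖ₑ) * eLpNorm U (ENNReal.ofReal p) volume := by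
  have e : (fun z => ∫ ξ, K (z - ξ) • U ξ) = fun z => ∫ t, K t • U (z - t) := by
    funext z
    rw [← integral_sub_left_eq_self _ _ z]
    simp
  rw [e]
  refine eLpNorm_integral_smul_le hp hK.measurable (hK.integrable_of_hasCompactSupport hc)
    (aestronglyMeasurable_sub_comp hU) fun t _ => ?_
  exact (eLpNorm_comp_measurePreserving hU (measurePreserving_sub_right volume t)).le

/-- Convolution with a probability density concentrated near the origin is close to the identity
in `L^p`. -/
lemma exists_eLpNorm_sub_mollify_le {p : ℝ} (hp : 1 < p) {G : Pt N → 𝕜}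
    (hG : MemLp G (ENNReal.ofReal p) volume) {ε : ℝ≥0∞} (hε : 0 < ε) :
    ∃ r : ℝ, 0 < r ∧ ∀ ρ : Pt N → ℝ, Continuous ρ → HasCompactSupport ρ → (∀ z, 0 ≤ ρ z) →
      ∫ z, ρ z = 1 → (∀ z, ρ z ≠ 0 → ‖z‖ < r) →
      eLpNorm (fun z => G z - ∫ ξ, ρ (z - ξ) • G ξ) (ENNReal.ofReal p) volume ≤ ε := by
  obtain ⟨r, hr, h⟩ := eLpNorm_sub_translate_le hp hG hε
  refine ⟨r, hr, fun ρ hρ hc h0 h1 hs => ?_⟩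
  have hint : Integrable ρ := hρ.integrable_of_hasCompactSupport hc
  have hl : LocallyIntegrable G := hG.locallyIntegrable (by simpa using hp.le)
  have e : (fun z => G z - ∫ ξ, ρ (z - ξ) • G ξ) = -fun z => ∫ t, ρ t • (G (z - t) - G z) := by
    funext z
    have e1 : ∫ ξ, ρ (z - ξ) • G ξ = ∫ t, ρ t • G (z - t) := by
      rw [← integral_sub_left_eq_self _ _ z]
      simp
    have i1 : Integrable fun t => ρ t • G (z - t) := by
      have : Integrable fun ξ => ρ (z - ξ) • G ξ := by
        refine hl.integrable_smul_left_of_hasCompactSupport (by fun_prop) ?_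
        exact hc.comp_homeomorph (Homeomorph.subLeft z)
      simpa using this.comp_sub_left z
    simp only [Pi.neg_apply, smul_sub]
    rw [integral_sub i1 (hint.smul_const _), integral_smul_const, h1, e1]
    simp
  rw [e, eLpNorm_neg]
  have hm : AEStronglyMeasurable (Function.uncurry fun z t : Pt N => G (z - t) - G z)
      (volume.prod volume) :=
    (aestronglyMeasurable_sub_comp hG.1).sub hG.1.comp_fst
  refine (eLpNorm_integral_smul_le hp hρ.measurable hint hm (B := ε)
    fun t ht => h t (hs t ht)).trans ?_
  have : ∫⁻ t, ‖ρ t‖ₑ = 1 := by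
    rw [← ofReal_integral_norm_eq_lintegral_enorm hint]
    simp [abs_of_nonneg (h0 _), h1]
  rw [this, one_mul]

/-- A convolution with a continuous kernel is an `L^p`-limit of Riemann sums. -/
lemma tendsto_eLpNorm_riemann {p : ℝ} (hp : 1 < p) {U : Pt N → 𝕜} (hU : Integrable U) {k : ℝ}
    (hk : ∀ ξ, k < ‖ξ‖ → U ξ = 0) {K : Pt N → ℝ} (hK : Continuous K) (hc : HasCompactSupport K) :
    Tendsto (fun n => eLpNorm (fun z => ∫ ξ, (K (z - ξ) -
        K (z - SimpleFunc.approxOn id measurable_id univ 0 (mem_univ (0 : Pt N)) n ξ)) • U ξ)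
      (ENNReal.ofReal p) volume) atTop (𝓝 0) := by
  set s := SimpleFunc.approxOn id measurable_id univ 0 (mem_univ (0 : Pt N)) with hs
  obtain ⟨C, hC⟩ := hc.exists_bound_of_continuous hK
  obtain ⟨R, hR0, hR⟩ := hc.isBounded.exists_pos_norm_le
  have hKR : ∀ z, R < ‖z‖ → K z = 0 := fun z hz =>
    image_eq_zero_of_notMem_tsupport fun h => absurd (hR z h) (not_le.2 hz)
  have hsn : ∀ n ξ, ‖s n ξ‖ ≤ 2 * ‖ξ‖ := by
    intro n ξ
    have := SimpleFunc.edist_approxOn_y0_le measurable_id (mem_univ (0 : Pt N)) ξ n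
    rw [← hs, edist_zero_left, id, edist_zero_left, ← two_mul] at this
    have h2 := ENNReal.toReal_mono (by finiteness) this
    simpa using h2
  have hst : ∀ ξ, Tendsto (fun n => s n ξ) atTop (𝓝 ξ) := fun ξ =>
    SimpleFunc.tendsto_approxOn measurable_id (mem_univ (0 : Pt N)) (by simp)
  have hb : ∀ n z ξ, ‖(K (z - ξ) - K (z - s n ξ)) • U ξ‖ ≤ (2 * C) * ‖U ξ‖ := by
    intro n z ξ
    rw [norm_smul]
    gcongr
    linarith [norm_sub_le (K (z - ξ)) (K (z - s n ξ)), hC (z - ξ), hC (z - s n ξ)]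
  have hm : ∀ n, AEStronglyMeasurable (Function.uncurry fun z ξ : Pt N =>
      (K (z - ξ) - K (z - s n ξ)) • U ξ) (volume.prod volume) := by
    intro n
    refine AEStronglyMeasurable.smul (Measurable.aestronglyMeasurable ?_) hU.1.comp_snd
    have := (s n).measurable
    exact (hK.measurable.comp (measurable_fst.sub measurable_snd)).sub
      (hK.measurable.comp (measurable_fst.sub (this.comp measurable_snd)))
  have hz : ∀ n z, AEStronglyMeasurable (fun ξ => (K (z - ξ) - K (z - s n ξ)) • U ξ) volume := by
    intro n z
    refine AEStronglyMeasurable.smul (Measurable.aestronglyMeasurable ?_) hU.1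
    have := (s n).measurable
    exact (hK.measurable.comp (measurable_const.sub measurable_id)).sub
      (hK.measurable.comp (measurable_const.sub this))
  have hbi : Integrable (fun ξ => (2 * C) * ‖U ξ‖) := hU.norm.const_mul _
  refine tendsto_eLpNorm_zero_of_dominated (by linarith) (fun n => (hm n).integral_prod_right')
    (g := (Metric.closedBall (0 : Pt N) (R + 2 * |k|)).indicator
      fun _ => ENNReal.ofReal (∫ ξ, (2 * C) * ‖U ξ‖)) ?_ (fun n => ae_of_all _ fun z => ?_)
    (ae_of_all _ fun z => ?_)
  · have : (fun z => (Metric.closedBall (0 : Pt N) (R + 2 * |k|)).indicator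
      (fun _ => ENNReal.ofReal (∫ ξ, (2 * C) * ‖U ξ‖)) z ^ p) =
      (Metric.closedBall (0 : Pt N) (R + 2 * |k|)).indicator
      fun _ => ENNReal.ofReal (∫ ξ, (2 * C) * ‖U ξ‖) ^ p := by
      funext z
      by_cases h : z ∈ Metric.closedBall (0 : Pt N) (R + 2 * |k|)
      · simp only [indicator_of_mem h]
      · simp only [indicator_of_notMem h]
        exact ENNReal.zero_rpow_of_pos (by linarith)
    rw [this, lintegral_indicator measurableSet_closedBall, setLIntegral_const]
    exact ENNReal.mul_ne_top (ENNReal.rpow_ne_top_of_nonneg (by linarith) ENNReal.ofReal_ne_top)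
      (measure_closedBall_lt_top (μ := (volume : Measure (Pt N)))).ne
  · by_cases h : z ∈ Metric.closedBall (0 : Pt N) (R + 2 * |k|)
    · rw [indicator_of_mem h, ← ofReal_norm]
      exact ENNReal.ofReal_le_ofReal
        (norm_integral_le_of_norm_le hbi (ae_of_all _ fun ξ => hb n z ξ))
    · rw [indicator_of_notMem h]
      rw [integral_eq_zero_of_ae]
      · simp
      refine ae_of_all _ fun ξ => ?_
      by_cases hξ : k < ‖ξ‖
      · simp [hk ξ hξ]
      · have h1 : R + 2 * |k| < ‖z‖ := by simpa using h
        have h2 := hsn n ξ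
        have h3 := le_abs_self k
        have h4 := abs_nonneg k
        have h5 := norm_sub_norm_le z ξ
        have h6 := norm_sub_norm_le z (s n ξ)
        simp only
        rw [hKR (z - ξ) (by linarith), hKR (z - s n ξ) (by linarith)]
        simp
  · have := tendsto_integral_of_dominated_convergence (fun ξ => (2 * C) * ‖U ξ‖)
      (f := fun _ => (0 : 𝕜)) (fun n => hz n z) hbi (fun n => ae_of_all _ fun ξ => hb n z ξ)
      (ae_of_all _ fun ξ => ?_)
    · simpa using this
    · have h1 : Tendsto (fun n => K (z - s n ξ)) atTop (𝓝 (K (z - ξ))) :=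
        (hK.tendsto _).comp (tendsto_const_nhds.sub (hst ξ))
      have h2 := (tendsto_const_nhds (x := K (z - ξ))).sub h1
      simpa using h2.smul_const (U ξ)

end Convolution

/-! ### Approximation by tensor products on strips -/

section Strip
open Filter Topology

variable {N : ℕ} {𝕜 : Type*} [RCLike 𝕜]

/-- The function `∑ f_i(x) g_i(y)`. -/
def tensorSum {n : ℕ} (f : Fin n → EuclideanSpace ℝ (Fin N) → 𝕜) (g : Fin n → ℝ → 𝕜) :
    Pt N → 𝕜 :=
  fun z => ∑ i, f i z.1 * g i z.2

variable (N) in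
/-- The strip `a ≤ y ≤ b`. -/
def strip (a b : ℝ) : Set (Pt N) := {z | z.2 ∈ Icc a b}

lemma isClosed_strip (a b : ℝ) : IsClosed (strip N a b) := isClosed_Icc.preimage continuous_snd

lemma measurableSet_strip (a b : ℝ) : MeasurableSet (strip N a b) := (isClosed_strip a b).measurableSet

lemma strip_subset_halfSpace {a b : ℝ} (ha : 0 < a) : strip N a b ⊆ halfSpace N :=
  fun _ hz => ha.trans_le hz.1

lemma pderivs_reflect {ρ : Pt N → ℝ} (hρ : ContDiff ℝ ∞ ρ) (L : List (Fin N ⊕ Unit)) (z : Pt N) :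
    pderivs L (fun ξ => ρ (z - ξ)) = fun ξ => (-1 : ℝ) ^ L.length * pderivs L ρ (z - ξ) := by
  induction L with
  | nil => simp [pderivs]
  | cons k L ih =>
    funext ξ
    rw [pderivs, ih, pderivs]
    have hd : HasFDerivAt (pderivs L ρ) (fderiv ℝ (pderivs L ρ) (z - ξ)) (z - ξ) :=
      ((contDiff_pderivs hρ L).differentiable (by simp) _).hasFDerivAt
    have h1 : HasFDerivAt (fun ξ => z - ξ) (-ContinuousLinearMap.id ℝ (Pt N)) ξ :=
      (hasFDerivAt_id ξ).const_sub z
    have h2 := (hd.comp ξ h1).const_mul ((-1 : ℝ) ^ L.length)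
    have h3 : HasFDerivAt (fun ξ => (-1 : ℝ) ^ L.length * pderivs L ρ (z - ξ)) _ ξ := h2
    simp only [pderiv]
    rw [h3.fderiv]
    simp [pow_succ]

lemma pderivs_sum_translate {ρ : Pt N → ℝ} (hρ : ContDiff ℝ ∞ ρ) (L : List (Fin N ⊕ Unit))
    (S : Finset (Pt N)) (A : Pt N → 𝕜) :
    pderivs L (fun z => ∑ c ∈ S, ρ (z - c) • A c) =
      fun z => ∑ c ∈ S, pderivs L ρ (z - c) • A c := by
  induction L with
  | nil => simp [pderivs]
  | cons k L ih =>
    funext z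
    rw [pderivs, ih, pderivs]
    have hd : ∀ c, HasFDerivAt (fun z => pderivs L ρ (z - c) • A c)
        ((fderiv ℝ (pderivs L ρ) (z - c)).smulRight (A c)) z := by
      intro c
      have h := ((contDiff_pderivs hρ L).differentiable (by simp) (z - c)).hasFDerivAt
      have h1 : HasFDerivAt (fun z => z - c) (ContinuousLinearMap.id ℝ (Pt N)) z :=
        (hasFDerivAt_id z).sub_const c
      exact (h.comp z h1).smul_const (A c)
    simp only [pderiv]
    rw [(HasFDerivAt.fun_sum fun c _ => hd c).fderiv]
    simp

/-- A smooth probability density of product form with small support. -/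
lemma exists_tensor_mollifier {r : ℝ} (hr : 0 < r) :
    ∃ (β : EuclideanSpace ℝ (Fin N) → ℝ) (γ : ℝ → ℝ), ContDiff ℝ ∞ β ∧ HasCompactSupport β ∧
      ContDiff ℝ ∞ γ ∧ HasCompactSupport (fun z : Pt N => β z.1 * γ z.2) ∧
      (∀ z : Pt N, 0 ≤ β z.1 * γ z.2) ∧ (∫ z : Pt N, β z.1 * γ z.2 = 1) ∧
      ∀ z : Pt N, β z.1 * γ z.2 ≠ 0 → ‖z‖ < r := by
  let b : ContDiffBump (0 : EuclideanSpace ℝ (Fin N)) := ⟨r / 2, r, by linarith, by linarith⟩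
  let c : ContDiffBump (0 : ℝ) := ⟨r / 2, r, by linarith, by linarith⟩
  refine ⟨b.normed volume, c.normed volume, b.contDiff_normed, b.hasCompactSupport_normed,
    c.contDiff_normed, ?_, fun z => mul_nonneg (b.nonneg_normed _) (c.nonneg_normed _), ?_, ?_⟩
  · refine HasCompactSupport.intro
      (b.hasCompactSupport_normed (μ := volume).isCompact.prod
        (c.hasCompactSupport_normed (μ := volume)).isCompact) fun z hz => ?_
    simp only [mem_prod, not_and_or] at hz
    rcases hz with hz | hz
    · rw [image_eq_zero_of_notMem_tsupport hz, zero_mul]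
    · rw [image_eq_zero_of_notMem_tsupport hz, mul_zero]
  · have := integral_prod_mul (μ := (volume : Measure (EuclideanSpace ℝ (Fin N))))
      (ν := (volume : Measure ℝ)) (b.normed volume) (c.normed volume)
    rw [b.integral_normed, c.integral_normed, one_mul] at this
    exact this
  · intro z hz
    have h1 : z.1 ∈ Function.support (b.normed volume) := left_ne_zero_of_mul hz
    have h2 : z.2 ∈ Function.support (c.normed volume) := right_ne_zero_of_mul hz
    rw [b.support_normed_eq] at h1
    rw [c.support_normed_eq] at h2
    rw [Prod.norm_def]
    exact max_lt (by simpa [b] using h1) (by simpa [c] using h2)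

/-- Weak derivatives pass from the kernel to the function in a convolution, at points whose
distance to the boundary exceeds the radius of the kernel. -/
lemma IsWeakDerivs.convolution_eq {L : List (Fin N ⊕ Unit)} {u G : Pt N → 𝕜}
    (h : IsWeakDerivs L u G) {a b a' b' r : ℝ} (ha' : 0 < a') (hra : r ≤ a - a') (hrb : r ≤ b' - b)
    {ρ : Pt N → ℝ} (hρ : ContDiff ℝ ∞ ρ) (hc : HasCompactSupport ρ) (hs : ∀ z, ρ z ≠ 0 → ‖z‖ < r)
    {z : Pt N} (hz : z ∈ strip N a b) :
    ∫ ξ, pderivs L ρ (z - ξ) • (strip N a' b').indicator u ξ =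
      ∫ ξ, ρ (z - ξ) • (strip N a' b').indicator G ξ := by
  have hts : tsupport ρ ⊆ Metric.closedBall 0 r := by
    refine closure_minimal (fun w hw => ?_) Metric.isClosed_closedBall
    simpa using (hs w hw).le
  have hmem : ∀ ξ, ξ ∉ strip N a' b' → z - ξ ∉ tsupport ρ := by
    intro ξ hξ hm
    apply hξ
    have h1 : ‖z - ξ‖ ≤ r := by simpa using hts hm
    have h2 : |z.2 - ξ.2| ≤ r := (norm_snd_le (z - ξ)).trans h1
    rw [abs_le] at h2
    have h3 := hz.1
    have h4 := hz.2
    exact ⟨by linarith, by linarith⟩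
  have hsub : tsupport (fun ξ => ρ (z - ξ)) ⊆ strip N a' b' := by
    refine closure_minimal (fun ξ hξ => ?_) (isClosed_strip _ _)
    by_contra hn
    exact hξ (image_eq_zero_of_notMem_tsupport (hmem ξ hn))
  have hφ : ContDiff ℝ ∞ (fun ξ => ρ (z - ξ)) := hρ.comp (contDiff_const.sub contDiff_id)
  have hw := h _ hφ (hc.comp_homeomorph (Homeomorph.subLeft z))
    (hsub.trans (strip_subset_halfSpace ha'))
  rw [pderivs_reflect hρ] at hw
  simp only [mul_smul] at hw
  rw [integral_smul] at hw
  have hw2 := smul_right_injective 𝕜 (pow_ne_zero L.length (by norm_num : (-1 : ℝ) ≠ 0)) hw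
  have key : ∀ (κ : Pt N → ℝ) (v : Pt N → 𝕜), tsupport κ ⊆ tsupport ρ →
      ∫ ξ, κ (z - ξ) • (strip N a' b').indicator v ξ = ∫ ξ in halfSpace N, κ (z - ξ) • v ξ := by
    intro κ v hκ
    rw [← integral_indicator isOpen_halfSpace.measurableSet]
    congr 1
    funext ξ
    by_cases hξ : ξ ∈ strip N a' b'
    · rw [indicator_of_mem hξ, indicator_of_mem (strip_subset_halfSpace ha' hξ)]
    · rw [indicator_of_notMem hξ, smul_zero, Set.indicator]
      rw [image_eq_zero_of_notMem_tsupport fun h' => hmem ξ hξ (hκ h')]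
      simp
  rw [key _ _ (tsupport_pderivs_subset ρ L), key _ _ subset_rfl]
  exact hw2

lemma aestronglyMeasurable_convolution {K : Pt N → ℝ} (hK : Continuous K) {U : Pt N → 𝕜}
    (hU : AEStronglyMeasurable U volume) :
    AEStronglyMeasurable (fun z => ∫ ξ, K (z - ξ) • U ξ) volume := by
  have : AEStronglyMeasurable (Function.uncurry fun z ξ : Pt N => K (z - ξ) • U ξ)
      (volume.prod volume) :=
    (hK.comp (continuous_fst.sub continuous_snd)).aestronglyMeasurable.smul hU.comp_snd
  exact this.integral_prod_right'

lemma integral_simpleFunc_smul {U : Pt N → 𝕜} (hU : Integrable U) (s : SimpleFunc (Pt N) (Pt N))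
    (K : Pt N → ℝ) (z : Pt N) :
    ∫ ξ, K (z - s ξ) • U ξ = ∑ c ∈ s.range, K (z - c) • ∫ ξ in s ⁻¹' {c}, U ξ := by
  have e : ∀ ξ, K (z - s ξ) • U ξ =
      ∑ c ∈ s.range, K (z - c) • (s ⁻¹' {c}).indicator U ξ := by
    intro ξ
    rw [Finset.sum_eq_single (s ξ)]
    · simp
    · intro c _ hc
      rw [indicator_of_notMem (by simpa using hc.symm), smul_zero]
    · intro h
      exact absurd (s.mem_range_self ξ) h
  simp_rw [e]
  rw [integral_finsetSum]
  · refine Finset.sum_congr rfl fun c _ => ?_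
    rw [integral_smul, integral_indicator (s.measurableSet_fiber c)]
  · intro c _
    exact (hU.indicator (s.measurableSet_fiber c)).smul (K (z - c))

/-- On a strip inside the half-space, a function with weak derivatives in `L^p` is approximated,
together with these derivatives, by tensor products of smooth functions. Mollifying with a kernel
of product form and replacing the convolution integral by a Riemann sum gives the approximation. -/
lemma exists_tensorSum_eLpNorm_le {p : ℝ} (hp : 1 < p) {u : Pt N → 𝕜}
    {Λ : Finset (List (Fin N ⊕ Unit))} {G : List (Fin N ⊕ Unit) → Pt N → 𝕜} {a b a' b' : ℝ}
    (ha' : 0 < a') (ha : a' < a) (hb : b < b') (hw : ∀ L ∈ Λ, IsWeakDerivs L u (G L))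
    (hu : MemLp u (ENNReal.ofReal p) (volume.restrict (strip N a' b')))
    (hG : ∀ L ∈ Λ, MemLp (G L) (ENNReal.ofReal p) (volume.restrict (strip N a' b')))
    {ε : ℝ≥0∞} (hε : 0 < ε) :
    ∃ (n : ℕ) (f : Fin n → EuclideanSpace ℝ (Fin N) → 𝕜) (g : Fin n → ℝ → 𝕜),
      (∀ i, ContDiff ℝ ∞ (f i) ∧ HasCompactSupport (f i)) ∧ (∀ i, ContDiff ℝ ∞ (g i)) ∧
      ∀ L ∈ Λ, eLpNorm (G L - pderivs L (tensorSum f g)) (ENNReal.ofReal p)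
        (volume.restrict (strip N a b)) ≤ ε := by
  have hp0 : 0 < p := by linarith
  have hp1 : 1 ≤ ENNReal.ofReal p := by simpa using hp.le
  set S := strip N a' b' with hS
  have hSm : MeasurableSet S := measurableSet_strip _ _
  have hη : 0 < ε / 3 := ENNReal.div_pos hε.ne' (by simp)
  have hU : MemLp (S.indicator u) (ENNReal.ofReal p) volume := (memLp_indicator_iff_restrict hSm).2 hu
  have hH : ∀ L ∈ Λ, MemLp (S.indicator (G L)) (ENNReal.ofReal p) volume := fun L hL =>
    (memLp_indicator_iff_restrict hSm).2 (hG L hL)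
  -- the radius of the mollifier
  have h1 : ∀ᶠ r in 𝓝[>] (0 : ℝ), ∀ L ∈ Λ, ∀ ρ : Pt N → ℝ, Continuous ρ → HasCompactSupport ρ →
      (∀ z, 0 ≤ ρ z) → ∫ z, ρ z = 1 → (∀ z, ρ z ≠ 0 → ‖z‖ < r) →
      eLpNorm (fun z => S.indicator (G L) z - ∫ ξ, ρ (z - ξ) • S.indicator (G L) ξ)
        (ENNReal.ofReal p) volume ≤ ε / 3 := by
    refine (Filter.eventually_all_finset Λ).2 fun L hL => ?_
    obtain ⟨r₀, hr₀, h⟩ := exists_eLpNorm_sub_mollify_le hp (hH L hL) hη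
    filter_upwards [Ioo_mem_nhdsGT hr₀] with r hr ρ k1 k2 k3 k4 k5
    exact h ρ k1 k2 k3 k4 fun z hz => (k5 z hz).trans hr.2
  have h2 : ∀ᶠ r in 𝓝[>] (0 : ℝ), 0 < r ∧ r < min (a - a') (b' - b) :=
    Ioo_mem_nhdsGT (lt_min (by linarith) (by linarith))
  obtain ⟨r, hmol, hr0, hr⟩ := (h1.and h2).exists
  have hra : r ≤ a - a' := hr.le.trans (min_le_left _ _)
  have hrb : r ≤ b' - b := hr.le.trans (min_le_right _ _)
  obtain ⟨β, γ, hβ, hβc, hγ, hρc, hρ0, hρ1, hρs⟩ := exists_tensor_mollifier (N := N) hr0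
  set ρ : Pt N → ℝ := fun z => β z.1 * γ z.2 with hρdef
  have hρ : ContDiff ℝ ∞ ρ := (hβ.comp contDiff_fst).mul (hγ.comp contDiff_snd)
  have hK : ∀ L, Continuous (pderivs L ρ) := fun L => (contDiff_pderivs hρ L).continuous
  have hKc : ∀ L, HasCompactSupport (pderivs L ρ) := fun L => hasCompactSupport_pderivs hρc L
  -- the truncation to a ball
  set B : ℕ → Set (Pt N) := fun k => Metric.closedBall 0 k with hB
  have h3 : ∀ᶠ k in atTop, ∀ L ∈ Λ,
      eLpNorm (fun z => ∫ ξ, pderivs L ρ (z - ξ) • (B k)ᶜ.indicator (S.indicator u) ξ)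
        (ENNReal.ofReal p) volume ≤ ε / 3 := by
    refine (Filter.eventually_all_finset Λ).2 fun L hL => ?_
    have ht := tendsto_eLpNorm_indicator_zero hp0 hU (S := fun k => (B k)ᶜ)
      (fun k => measurableSet_closedBall.compl) (ae_of_all _ fun x => by
        obtain ⟨k, hk⟩ := exists_nat_ge ‖x‖
        filter_upwards [eventually_ge_atTop k] with n hn
        have : (k : ℝ) ≤ n := by exact_mod_cast hn
        simpa [hB] using hk.trans this)
    have hfin : (∫⁻ t, ‖pderivs L ρ t‖ₑ) ≠ ⊤ :=
      ((hK L).integrable_of_hasCompactSupport (μ := volume) (hKc L)).2.ne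
    have ht2 := ENNReal.Tendsto.const_mul ht (Or.inr hfin)
    rw [mul_zero] at ht2
    filter_upwards [ht2.eventually_le_const hη] with k hk
    exact (eLpNorm_convolution_le hp (hK L) (hKc L)
      (hU.1.indicator measurableSet_closedBall.compl)).trans hk
  obtain ⟨k, hk⟩ := h3.exists
  set V := (B k).indicator (S.indicator u) with hV
  have hVi : Integrable V := by
    rw [hV, integrable_indicator_iff measurableSet_closedBall]
    exact (hU.locallyIntegrable hp1).integrableOn_isCompact (isCompact_closedBall _ _)
  have hV0 : ∀ ξ, (k : ℝ) < ‖ξ‖ → V ξ = 0 := fun ξ hξ =>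
    indicator_of_notMem (by simpa [hB] using hξ) _
  -- the Riemann sum
  have h4 := (Filter.eventually_all_finset Λ).2 fun L _ =>
    (tendsto_eLpNorm_riemann hp hVi hV0 (hK L) (hKc L)).eventually_le_const hη
  obtain ⟨n, hn⟩ := h4.exists
  set s := SimpleFunc.approxOn id measurable_id univ 0 (mem_univ (0 : Pt N)) n with hs
  set A : Pt N → 𝕜 := fun c => ∫ ξ in s ⁻¹' {c}, V ξ with hA
  let c : Fin s.range.card → Pt N := fun i => (s.range.equivFin.symm i : Pt N)
  have hsum : tensorSum (fun i x => (β (x - (c i).1) : 𝕜) * A (c i))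
      (fun i y => (γ (y - (c i).2) : 𝕜)) = fun z => ∑ c ∈ s.range, ρ (z - c) • A c := by
    funext z
    rw [tensorSum, ← Finset.sum_coe_sort s.range, ← s.range.equivFin.symm.sum_comp]
    refine Finset.sum_congr rfl fun i _ => ?_
    simp only [hρdef, RCLike.real_smul_eq_coe_mul, Prod.fst_sub, Prod.snd_sub, c]
    push_cast
    ring
  have hβ' : ContDiff ℝ ∞ (fun x => (β x : 𝕜)) := (RCLike.ofRealCLM (K := 𝕜)).contDiff.comp hβ
  have hγ' : ContDiff ℝ ∞ (fun x => (γ x : 𝕜)) := (RCLike.ofRealCLM (K := 𝕜)).contDiff.comp hγ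
  refine ⟨_, fun i x => (β (x - (c i).1) : 𝕜) * A (c i), fun i y => (γ (y - (c i).2) : 𝕜),
    fun i => ⟨?_, ?_⟩, fun i => ?_, fun L hL => ?_⟩
  · exact (hβ'.comp (contDiff_id.sub contDiff_const)).mul contDiff_const
  · have hcs : HasCompactSupport (fun x => β (x - (c i).1)) :=
      hβc.comp_homeomorph (Homeomorph.subRight (c i).1)
    refine hcs.mono fun x hx => ?_
    have := left_ne_zero_of_mul hx
    simpa using this
  · exact hγ'.comp (contDiff_id.sub contDiff_const)
  · rw [hsum, pderivs_sum_translate hρ]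
    set E1 : Pt N → 𝕜 := fun z => S.indicator (G L) z - ∫ ξ, ρ (z - ξ) • S.indicator (G L) ξ with hE1
    set E2 : Pt N → 𝕜 := fun z => ∫ ξ, pderivs L ρ (z - ξ) • (B k)ᶜ.indicator (S.indicator u) ξ
      with hE2
    set E3 : Pt N → 𝕜 := fun z => ∫ ξ, (pderivs L ρ (z - ξ) - pderivs L ρ (z - s ξ)) • V ξ with hE3
    have hi1 : ∀ z, Integrable fun ξ => pderivs L ρ (z - ξ) • S.indicator u ξ := fun z =>
      (hU.locallyIntegrable hp1).integrable_smul_left_of_hasCompactSupport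
        ((hK L).comp (continuous_const.sub continuous_id))
        ((hKc L).comp_homeomorph (Homeomorph.subLeft z))
    have hi2 : ∀ z, Integrable fun ξ => pderivs L ρ (z - ξ) • V ξ := fun z =>
      hVi.locallyIntegrable.integrable_smul_left_of_hasCompactSupport
        ((hK L).comp (continuous_const.sub continuous_id))
        ((hKc L).comp_homeomorph (Homeomorph.subLeft z))
    obtain ⟨C, hC⟩ := (hKc L).exists_bound_of_continuous (hK L)
    have hi3 : ∀ z, Integrable fun ξ => pderivs L ρ (z - s ξ) • V ξ := fun z =>
      hVi.bdd_smul C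
        ((hK L).measurable.comp (measurable_const.sub s.measurable)).aestronglyMeasurable
        (ae_of_all _ fun ξ => hC _)
    have hs3 : ∀ z, ∑ c ∈ s.range, pderivs L ρ (z - c) • A c = ∫ ξ, pderivs L ρ (z - s ξ) • V ξ :=
      fun z => (integral_simpleFunc_smul hVi s _ z).symm
    have hE2' : ∀ z, E2 z = (∫ ξ, pderivs L ρ (z - ξ) • S.indicator u ξ) -
        ∫ ξ, pderivs L ρ (z - ξ) • V ξ := by
      intro z
      rw [← integral_sub (hi1 z) (hi2 z)]
      simp only [hE2, hV, indicator_compl, Pi.sub_apply, smul_sub]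
    have hE3' : ∀ z, E3 z = (∫ ξ, pderivs L ρ (z - ξ) • V ξ) -
        ∑ c ∈ s.range, pderivs L ρ (z - c) • A c := by
      intro z
      rw [hs3, ← integral_sub (hi2 z) (hi3 z)]
      simp only [hE3, sub_smul]
    have hsS : strip N a b ⊆ S := fun z hz => ⟨by have := hz.1; linarith, by have := hz.2; linarith⟩
    have hdec : ∀ z ∈ strip N a b, (G L - fun z => ∑ c ∈ s.range, pderivs L ρ (z - c) • A c) z =
        (E1 + E2 + E3) z := by
      intro z hz
      simp only [Pi.sub_apply, Pi.add_apply]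
      rw [hE2', hE3', hE1]
      simp only
      rw [← (hw L hL).convolution_eq ha' hra hrb hρ hρc hρs hz, indicator_of_mem (hsS hz)]
      ring
    have hm1 : AEStronglyMeasurable E1 volume :=
      (hH L hL).1.sub (aestronglyMeasurable_convolution hρ.continuous (hH L hL).1)
    have hm2 : AEStronglyMeasurable E2 volume := aestronglyMeasurable_convolution (hK L)
      (hU.1.indicator measurableSet_closedBall.compl)
    have hm3 : AEStronglyMeasurable E3 volume := by
      have : E3 = fun z => (∫ ξ, pderivs L ρ (z - ξ) • V ξ) -
        ∑ c ∈ s.range, pderivs L ρ (z - c) • A c := funext hE3'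
      rw [this]
      refine (aestronglyMeasurable_convolution (hK L) hVi.1).sub (Continuous.aestronglyMeasurable ?_)
      exact continuous_finsetSum _ fun c _ =>
        ((hK L).comp (continuous_id.sub continuous_const)).smul continuous_const
    calc eLpNorm (G L - fun z => ∑ c ∈ s.range, pderivs L ρ (z - c) • A c) (ENNReal.ofReal p)
          (volume.restrict (strip N a b))
        = eLpNorm (E1 + E2 + E3) (ENNReal.ofReal p) (volume.restrict (strip N a b)) :=
          eLpNorm_congr_ae (ae_restrict_of_forall_mem (measurableSet_strip _ _) hdec)
      _ ≤ eLpNorm (E1 + E2 + E3) (ENNReal.ofReal p) volume :=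
          eLpNorm_mono_measure _ Measure.restrict_le_self
      _ ≤ eLpNorm E1 (ENNReal.ofReal p) volume + eLpNorm E2 (ENNReal.ofReal p) volume +
          eLpNorm E3 (ENNReal.ofReal p) volume :=
          (eLpNorm_add_le (hm1.add hm2) hm3 hp1).trans
            (add_le_add (eLpNorm_add_le hm1 hm2 hp1) le_rfl)
      _ ≤ ε / 3 + ε / 3 + ε / 3 :=
          add_le_add (add_le_add (hmol L hL ρ hρ.continuous hρc hρ0 hρ1 hρs) (hk L hL)) (hn L hL)
      _ = ε := ENNReal.add_thirds ε

end Strip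

/-! ### Regularization at the boundary: functions constant in `y` for small `y` -/

section Cutoff

/-- A smooth function equal to `1` on `(-∞, 1]` and to `0` on `[2, ∞)`. -/
def cutoff (t : ℝ) : ℝ := Real.smoothTransition (2 - t)

lemma contDiff_cutoff : ContDiff ℝ ∞ cutoff :=
  Real.smoothTransition.contDiff.comp (contDiff_const.sub contDiff_id)

lemma cutoff_nonneg (t : ℝ) : 0 ≤ cutoff t := Real.smoothTransition.nonneg _

lemma cutoff_le_one (t : ℝ) : cutoff t ≤ 1 := Real.smoothTransition.le_one _

lemma cutoff_of_le {t : ℝ} (h : t ≤ 1) : cutoff t = 1 :=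
  Real.smoothTransition.one_of_one_le (by linarith)

lemma cutoff_of_ge {t : ℝ} (h : 2 ≤ t) : cutoff t = 0 :=
  Real.smoothTransition.zero_of_nonpos (by linarith)

lemma contDiff_deriv_cutoff : ContDiff ℝ ∞ (deriv cutoff) :=
  ((contDiff_infty_iff_deriv).1 contDiff_cutoff).2

lemma contDiff_deriv_deriv_cutoff : ContDiff ℝ ∞ (deriv (deriv cutoff)) :=
  ((contDiff_infty_iff_deriv).1 contDiff_deriv_cutoff).2

lemma deriv_cutoff_of_notMem {t : ℝ} (h : t ∉ Icc 1 2) : deriv cutoff t = 0 := by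
  rw [mem_Icc, not_and_or, not_le, not_le] at h
  rcases h with h | h
  · have : cutoff =ᶠ[nhds t] fun _ => 1 := by
      filter_upwards [Iio_mem_nhds h] with s hs using cutoff_of_le (le_of_lt hs)
    rw [this.deriv_eq, deriv_const]
  · have : cutoff =ᶠ[nhds t] fun _ => 0 := by
      filter_upwards [Ioi_mem_nhds h] with s hs using cutoff_of_ge (le_of_lt hs)
    rw [this.deriv_eq, deriv_const]

lemma deriv_deriv_cutoff_of_notMem {t : ℝ} (h : t ∉ Icc 1 2) : deriv (deriv cutoff) t = 0 := by
  have : deriv cutoff =ᶠ[nhds t] fun _ => 0 := by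
    filter_upwards [isClosed_Icc.isOpen_compl.mem_nhds h] with s hs
      using deriv_cutoff_of_notMem hs
  rw [this.deriv_eq, deriv_const]

lemma exists_deriv_cutoff_le : ∃ C : ℝ, 0 ≤ C ∧ (∀ t, |deriv cutoff t| ≤ C) ∧
    ∀ t, |deriv (deriv cutoff) t| ≤ C := by
  obtain ⟨C₁, h₁⟩ := isCompact_Icc.exists_bound_of_continuousOn (s := Icc (1 : ℝ) 2)
    contDiff_deriv_cutoff.continuous.continuousOn
  obtain ⟨C₂, h₂⟩ := isCompact_Icc.exists_bound_of_continuousOn (s := Icc (1 : ℝ) 2)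
    contDiff_deriv_deriv_cutoff.continuous.continuousOn
  refine ⟨max 0 (max C₁ C₂), le_max_left _ _, fun t => ?_, fun t => ?_⟩
  · by_cases ht : t ∈ Icc (1 : ℝ) 2
    · exact (h₁ t ht).trans ((le_max_left _ _).trans (le_max_right _ _))
    · rw [deriv_cutoff_of_notMem ht, abs_zero]; exact le_max_left _ _
  · by_cases ht : t ∈ Icc (1 : ℝ) 2
    · exact (h₂ t ht).trans ((le_max_right _ _).trans (le_max_right _ _))
    · rw [deriv_deriv_cutoff_of_notMem ht, abs_zero]; exact le_max_left _ _

end Cutoff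

section Regularize
variable {N : ℕ} {𝕜 : Type*} [RCLike 𝕜]

/-- The mean of `g` over `[1/r, 2/r]`. -/
def mean (r : ℝ) (g : ℝ → 𝕜) : 𝕜 := r • ∫ s in (1 / r)..(2 / r), g s

/-- The function `g`, cut off at height `r` and replaced by its mean over `[1/r, 2/r]` below
that interval. -/
def regularize (r : ℝ) (g : ℝ → 𝕜) (y : ℝ) : 𝕜 :=
  (cutoff (y / r) - cutoff (r * y)) • g y + cutoff (r * y) • mean r g

/-- The mean in `y` of a function on the half-space, as a function of `(x, y)`. -/
def meanY (r : ℝ) (w : Pt N → 𝕜) (z : Pt N) : 𝕜 := mean r fun s => w (z.1, s)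

lemma contDiff_regularize (r : ℝ) {g : ℝ → 𝕜} (hg : ContDiff ℝ ∞ g) :
    ContDiff ℝ ∞ (regularize r g) :=
  (((contDiff_cutoff.comp (contDiff_id.div_const r)).sub
    (contDiff_cutoff.comp (contDiff_const.mul contDiff_id))).smul hg).add
    ((contDiff_cutoff.comp (contDiff_const.mul contDiff_id)).smul contDiff_const)

lemma regularize_of_le {r : ℝ} (hr : 1 ≤ r) (g : ℝ → 𝕜) {y : ℝ} (hy : y ≤ 1 / r) :
    regularize r g y = mean r g := by
  have hr0 : 0 < r := by linarith
  have h1 : r * y ≤ 1 := by rwa [le_div_iff₀ hr0, mul_comm] at hy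
  have h2 : y / r ≤ 1 := by
    rw [div_le_one hr0]
    exact hy.trans (by rw [div_le_iff₀ hr0]; nlinarith)
  simp [regularize, cutoff_of_le h1, cutoff_of_le h2]

lemma regularize_of_ge {r : ℝ} (hr : 1 ≤ r) (g : ℝ → 𝕜) {y : ℝ} (hy : 2 * r ≤ y) :
    regularize r g y = 0 := by
  have hr0 : 0 < r := by linarith
  have h1 : 2 ≤ y / r := by rwa [le_div_iff₀ hr0]
  have h2 : 2 ≤ r * y := by nlinarith
  simp [regularize, cutoff_of_ge h1, cutoff_of_ge h2]

lemma memD_regularize {r : ℝ} (hr : 1 ≤ r) {g : ℝ → 𝕜} (hg : ContDiff ℝ ∞ g) :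
    MemD (regularize r g) := by
  have hr0 : 0 < r := by linarith
  refine ⟨(contDiff_regularize r hg).contDiffOn, ⟨2 * r, fun y hy => regularize_of_ge hr g hy⟩,
    1 / r / 2, by positivity, fun y hy => ?_⟩
  have h1 : y < 1 / r := hy.2.trans_lt (half_lt_self (by positivity))
  have : regularize r g =ᶠ[nhds y] fun _ => mean r g := by
    filter_upwards [Iio_mem_nhds h1] with s hs using regularize_of_le hr g (le_of_lt hs)
  rw [(this.filter_mono nhdsWithin_le_nhds).derivWithin_eq this.eq_of_nhds]
  simp

lemma hasDerivAt_regularize (r : ℝ) {g g' : ℝ → 𝕜} {y : ℝ} (hg : HasDerivAt g (g' y) y) (M : 𝕜) :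
    HasDerivAt (fun y => (cutoff (y / r) - cutoff (r * y)) • g y + cutoff (r * y) • M)
      ((cutoff (y / r) - cutoff (r * y)) • g' y + (r⁻¹ * deriv cutoff (y / r)) • g y -
        (r * deriv cutoff (r * y)) • (g y - M)) y := by
  have hc : ∀ t, HasDerivAt cutoff (deriv cutoff t) t := fun t =>
    (contDiff_cutoff.differentiable (by simp) t).hasDerivAt
  have h1 : HasDerivAt (fun y => cutoff (y / r)) (deriv cutoff (y / r) * (1 / r)) y :=
    HasDerivAt.comp (h₂ := cutoff) y (hc (y / r)) ((hasDerivAt_id y).div_const r)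
  have h2 : HasDerivAt (fun y => cutoff (r * y)) (deriv cutoff (r * y) * (r * 1)) y :=
    HasDerivAt.comp (h₂ := cutoff) y (hc (r * y)) ((hasDerivAt_id y).const_mul r)
  refine (((h1.sub h2).smul hg).add (h2.smul_const M)).congr_deriv ?_
  simp only [Pi.sub_apply, RCLike.real_smul_eq_coe_mul]
  push_cast
  ring

lemma deriv_regularize (r : ℝ) {g : ℝ → 𝕜} (hg : ContDiff ℝ ∞ g) :
    deriv (regularize r g) = fun y => (cutoff (y / r) - cutoff (r * y)) • deriv g y +
      (r⁻¹ * deriv cutoff (y / r)) • g y - (r * deriv cutoff (r * y)) • (g y - mean r g) :=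
  funext fun y => (hasDerivAt_regularize r (g' := deriv g)
    (hg.differentiable (by simp) y).hasDerivAt (mean r g)).deriv

lemma deriv_deriv_regularize (r : ℝ) {g : ℝ → 𝕜} (hg : ContDiff ℝ ∞ g) :
    deriv (deriv (regularize r g)) = fun y =>
      (cutoff (y / r) - cutoff (r * y)) • deriv (deriv g) y +
      (2 * (r⁻¹ * deriv cutoff (y / r))) • deriv g y -
      (2 * (r * deriv cutoff (r * y))) • deriv g y +
      (r⁻¹ ^ 2 * deriv (deriv cutoff) (y / r)) • g y -
      (r ^ 2 * deriv (deriv cutoff) (r * y)) • (g y - mean r g) := by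
  have hg' : ContDiff ℝ ∞ (deriv g) := ((contDiff_infty_iff_deriv).1 hg).2
  rw [deriv_regularize r hg]
  funext y
  have hc : ∀ t, HasDerivAt (deriv cutoff) (deriv (deriv cutoff) t) t := fun t =>
    (contDiff_deriv_cutoff.differentiable (by simp) t).hasDerivAt
  have h1 : HasDerivAt (fun y => r⁻¹ * deriv cutoff (y / r))
      (r⁻¹ * (deriv (deriv cutoff) (y / r) * (1 / r))) y :=
    ((hc (y / r)).comp y ((hasDerivAt_id y).div_const r)).const_mul _
  have h2 : HasDerivAt (fun y => r * deriv cutoff (r * y))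
      (r * (deriv (deriv cutoff) (r * y) * (r * 1))) y :=
    ((hc (r * y)).comp y ((hasDerivAt_id y).const_mul r)).const_mul _
  have hd := (hg.differentiable (by simp) y).hasDerivAt
  have hd' := (hg'.differentiable (by simp) y).hasDerivAt
  have h0 := hasDerivAt_regularize r hd' 0
  simp only [smul_zero, add_zero, sub_zero] at h0
  have := (h0.add (h1.smul hd)).sub (h2.smul (hd.sub_const (mean r g)))
  refine (this.congr_deriv ?_).deriv
  simp only [RCLike.real_smul_eq_coe_mul]
  push_cast
  ring

/-! ### Derivatives of tensor sums -/

variable {n : ℕ} {f : Fin n → EuclideanSpace ℝ (Fin N) → 𝕜} {g : Fin n → ℝ → 𝕜}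

lemma contDiff_tensorSum (hf : ∀ j, ContDiff ℝ ∞ (f j)) (hg : ∀ j, ContDiff ℝ ∞ (g j)) :
    ContDiff ℝ ∞ (tensorSum f g) :=
  ContDiff.sum fun j _ => ((hf j).comp contDiff_fst).mul ((hg j).comp contDiff_snd)

lemma fderiv_tensorSum (hf : ∀ j, ContDiff ℝ ∞ (f j)) (hg : ∀ j, ContDiff ℝ ∞ (g j))
    (z v : Pt N) : fderiv ℝ (tensorSum f g) z v =
      ∑ j, (fderiv ℝ (f j) z.1 v.1 * g j z.2 + f j z.1 * (v.2 • deriv (g j) z.2)) := by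
  have h1 : ∀ j, HasFDerivAt (fun z : Pt N => f j z.1)
      ((fderiv ℝ (f j) z.1).comp (ContinuousLinearMap.fst ℝ _ _)) z := fun j =>
    (((hf j).differentiable (by simp) z.1).hasFDerivAt).comp z hasFDerivAt_fst
  have h2 : ∀ j, HasFDerivAt (fun z : Pt N => g j z.2)
      ((fderiv ℝ (g j) z.2).comp (ContinuousLinearMap.snd ℝ _ _)) z := fun j =>
    (((hg j).differentiable (by simp) z.2).hasFDerivAt).comp z hasFDerivAt_snd
  have h : HasFDerivAt (tensorSum f g) _ z :=
    HasFDerivAt.fun_sum (u := Finset.univ) fun j _ => (h1 j).mul (h2 j)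
  rw [h.fderiv]
  simp only [FunLike.coe_sum, Finset.sum_apply]
  refine Finset.sum_congr rfl fun j _ => ?_
  have : fderiv ℝ (g j) z.2 v.2 = v.2 • deriv (g j) z.2 := by
    rw [← fderiv_apply_one_eq_deriv, ← map_smul]; simp
  simp [this]
  ring

lemma pderiv_inl_tensorSum (hf : ∀ j, ContDiff ℝ ∞ (f j)) (hg : ∀ j, ContDiff ℝ ∞ (g j))
    (i : Fin N) : pderiv (Sum.inl i) (tensorSum f g) =
      tensorSum (fun j x => fderiv ℝ (f j) x (EuclideanSpace.single i 1)) g := by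
  funext z
  rw [pderiv, fderiv_tensorSum hf hg]
  simp [tensorSum, coordVec]

lemma pderiv_inr_tensorSum (hf : ∀ j, ContDiff ℝ ∞ (f j)) (hg : ∀ j, ContDiff ℝ ∞ (g j)) :
    pderiv (Sum.inr ()) (tensorSum f g) = tensorSum f (fun j => deriv (g j)) := by
  funext z
  rw [pderiv, fderiv_tensorSum hf hg]
  simp [tensorSum, coordVec]

/-- Tangential derivatives of a tensor sum act on the first factors only. -/
lemma exists_pderivs_inl_tensorSum (hf : ∀ j, ContDiff ℝ ∞ (f j) ∧ HasCompactSupport (f j))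
    (L : List (Fin N)) : ∃ f' : Fin n → EuclideanSpace ℝ (Fin N) → 𝕜,
      (∀ j, ContDiff ℝ ∞ (f' j) ∧ HasCompactSupport (f' j)) ∧
      ∀ g : Fin n → ℝ → 𝕜, (∀ j, ContDiff ℝ ∞ (g j)) →
        pderivs (L.map Sum.inl) (tensorSum f g) = tensorSum f' g := by
  induction L with
  | nil => exact ⟨f, hf, fun g _ => rfl⟩
  | cons i L ih =>
    obtain ⟨f', hf', h⟩ := ih
    refine ⟨fun j x => fderiv ℝ (f' j) x (EuclideanSpace.single i 1), fun j => ⟨?_, ?_⟩,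
      fun g hg => ?_⟩
    · exact ((hf' j).1.fderiv_right (m := ∞) (by simp)).clm_apply contDiff_const
    · exact (hf' j).2.fderiv_apply ℝ _
    · rw [List.map_cons, pderivs, h g hg, pderiv_inl_tensorSum (fun j => (hf' j).1) hg]

lemma meanY_tensorSum (hg : ∀ j, Continuous (g j)) (r : ℝ) (z : Pt N) :
    meanY r (tensorSum f g) z = ∑ j, f j z.1 * mean r (g j) := by
  simp only [meanY, mean, tensorSum]
  rw [intervalIntegral.integral_finsetSum]
  · rw [Finset.smul_sum]
    refine Finset.sum_congr rfl fun j _ => ?_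
    rw [intervalIntegral.integral_const_mul, mul_smul_comm]
  · intro j _
    exact (continuous_const.mul (hg j)).intervalIntegrable _ _

lemma tensorSum_regularize (hg : ∀ j, Continuous (g j)) (r : ℝ) (z : Pt N) :
    tensorSum f (fun j => regularize r (g j)) z =
      (cutoff (z.2 / r) - cutoff (r * z.2)) • tensorSum f g z +
        cutoff (r * z.2) • meanY r (tensorSum f g) z := by
  rw [meanY_tensorSum hg]
  simp only [tensorSum, regularize, Finset.smul_sum, ← Finset.sum_add_distrib]
  refine Finset.sum_congr rfl fun j _ => ?_
  simp only [RCLike.real_smul_eq_coe_mul]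
  ring

lemma tensorSum_deriv_regularize (hg : ∀ j, ContDiff ℝ ∞ (g j)) (r : ℝ) (z : Pt N) :
    tensorSum f (fun j => deriv (regularize r (g j))) z =
      (cutoff (z.2 / r) - cutoff (r * z.2)) • tensorSum f (fun j => deriv (g j)) z +
      (r⁻¹ * deriv cutoff (z.2 / r)) • tensorSum f g z -
      (r * deriv cutoff (r * z.2)) • (tensorSum f g z - meanY r (tensorSum f g) z) := by
  rw [meanY_tensorSum fun j => (hg j).continuous]
  simp only [tensorSum, deriv_regularize r (hg _), Finset.smul_sum, ← Finset.sum_add_distrib,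
    ← Finset.sum_sub_distrib]
  refine Finset.sum_congr rfl fun j _ => ?_
  simp only [RCLike.real_smul_eq_coe_mul]
  ring

lemma tensorSum_deriv_deriv_regularize (hg : ∀ j, ContDiff ℝ ∞ (g j)) (r : ℝ) (z : Pt N) :
    tensorSum f (fun j => deriv (deriv (regularize r (g j)))) z =
      (cutoff (z.2 / r) - cutoff (r * z.2)) • tensorSum f (fun j => deriv (deriv (g j))) z +
      (2 * (r⁻¹ * deriv cutoff (z.2 / r))) • tensorSum f (fun j => deriv (g j)) z -
      (2 * (r * deriv cutoff (r * z.2))) • tensorSum f (fun j => deriv (g j)) z +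
      (r⁻¹ ^ 2 * deriv (deriv cutoff) (z.2 / r)) • tensorSum f g z -
      (r ^ 2 * deriv (deriv cutoff) (r * z.2)) •
        (tensorSum f g z - meanY r (tensorSum f g) z) := by
  rw [meanY_tensorSum fun j => (hg j).continuous]
  simp only [tensorSum, deriv_deriv_regularize r (hg _), Finset.smul_sum,
    ← Finset.sum_add_distrib, ← Finset.sum_sub_distrib]
  refine Finset.sum_congr rfl fun j _ => ?_
  simp only [RCLike.real_smul_eq_coe_mul]
  ring

/-! ### Pointwise bounds for means -/

lemma enorm_mean_le {r : ℝ} (hr : 0 < r) (g : ℝ → 𝕜) :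
    ‖mean r g‖ₑ ≤ ENNReal.ofReal r * ∫⁻ s in Icc (1 / r) (2 / r), ‖g s‖ₑ := by
  have h : 1 / r ≤ 2 / r := by gcongr; norm_num
  rw [mean, enorm_smul, Real.enorm_eq_ofReal hr.le, intervalIntegral.integral_of_le h]
  gcongr
  exact (enorm_integral_le_lintegral_enorm _).trans
    (lintegral_mono_set Ioc_subset_Icc_self)

/-- One-dimensional Poincaré inequality on `[1/r, 2/r]`. -/
lemma enorm_sub_mean_le {r : ℝ} (hr : 0 < r) {g : ℝ → 𝕜} (hg : ContDiff ℝ ∞ g) {y : ℝ}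
    (hy : y ∈ Icc (1 / r) (2 / r)) :
    ‖g y - mean r g‖ₑ ≤ ∫⁻ s in Icc (1 / r) (2 / r), ‖deriv g s‖ₑ := by
  have h : 1 / r ≤ 2 / r := by gcongr; norm_num
  have hlen : 2 / r - 1 / r = r⁻¹ := by field_simp; norm_num
  have hg' : Continuous (deriv g) := (((contDiff_infty_iff_deriv).1 hg).2).continuous
  have hint : IntegrableOn (deriv g) (Icc (1 / r) (2 / r)) :=
    hg'.continuousOn.integrableOn_compact isCompact_Icc
  set M := ∫ s in Icc (1 / r) (2 / r), ‖deriv g s‖ with hM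
  have hb : ∀ s ∈ Icc (1 / r) (2 / r), ‖g y - g s‖ ≤ M := by
    intro s hs
    rw [← intervalIntegral.integral_deriv_eq_sub (a := s) (b := y)
      (fun t _ => hg.differentiable (by simp) t) (hg'.intervalIntegrable _ _)]
    refine (intervalIntegral.norm_integral_le_integral_norm_uIoc).trans ?_
    refine setIntegral_mono_set hint.norm (ae_of_all _ fun _ => norm_nonneg _) ?_
    exact LE.le.eventuallyLE (uIoc_subset_uIcc.trans
      (uIcc_subset_Icc hs hy))
  have e : g y - mean r g = r • ∫ s in (1 / r)..(2 / r), (g y - g s) := by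
    rw [intervalIntegral.integral_sub (by simp) (hg.continuous.intervalIntegrable _ _),
      intervalIntegral.integral_const, hlen, smul_sub, smul_smul, mul_inv_cancel₀ hr.ne', one_smul,
      mean]
  have hn : ‖g y - mean r g‖ ≤ M := by
    rw [e, norm_smul, Real.norm_of_nonneg hr.le]
    have := intervalIntegral.norm_integral_le_of_norm_le_const (a := 1 / r) (b := 2 / r) (C := M)
      (f := fun s => g y - g s) (fun s hs => hb s (by
        rw [uIoc_of_le h] at hs; exact Ioc_subset_Icc_self hs))
    rw [hlen, abs_of_nonneg (inv_nonneg.2 hr.le)] at this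
    calc r * _ ≤ r * (M * r⁻¹) := by gcongr
      _ = M := by field_simp
  rw [← ofReal_norm, ← ofReal_integral_norm_eq_lintegral_enorm hint]
  exact ENNReal.ofReal_le_ofReal hn

end Regularize

/-! ### Weighted norms -/

section Weighted
variable {N : ℕ} {𝕜 : Type*} [RCLike 𝕜] {p m a : ℝ}

lemma measurable_weight (q : ℝ) : Measurable fun z : Pt N => ENNReal.ofReal (z.2 ^ q) :=
  (measurable_snd.pow_const q).ennreal_ofReal

lemma ae_weightedMeasure_of_halfSpace {P : Pt N → Prop} (h : ∀ z ∈ halfSpace N, P z) :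
    ∀ᵐ z ∂weightedMeasure N m, P z :=
  (weightedMeasure_absolutelyContinuous m).ae_le
    (ae_restrict_of_forall_mem isOpen_halfSpace.measurableSet h)

lemma normLpm_yPow_rpow (hp : 0 < p) (F : Pt N → 𝕜) :
    normLpm p m (yPow a F) ^ p =
      ∫⁻ z in halfSpace N, ENNReal.ofReal (z.2 ^ (a * p + m)) * ‖F z‖ₑ ^ p := by
  rw [normLpm, eLpNorm_ofReal_rpow hp, weightedMeasure,
    lintegral_withDensity_eq_lintegral_mul_non_measurable _ (measurable_weight m) (by simp)]
  refine setLIntegral_congr_fun isOpen_halfSpace.measurableSet fun z hz => ?_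
  have hz0 : 0 < z.2 := hz
  simp only [Pi.mul_apply, yPow, enorm_smul]
  rw [ENNReal.mul_rpow_of_nonneg _ _ hp.le, ← mul_assoc]
  congr 1
  rw [Real.enorm_eq_ofReal (by positivity), ENNReal.ofReal_rpow_of_nonneg (by positivity) hp.le,
    ← ENNReal.ofReal_mul (by positivity), ← Real.rpow_mul hz0.le, ← Real.rpow_add hz0, add_comm]

lemma aestronglyMeasurable_yPow {F : Pt N → 𝕜}
    (hF : AEStronglyMeasurable F (volume.restrict (halfSpace N))) (m a : ℝ) :
    AEStronglyMeasurable (yPow a F) (weightedMeasure N m) :=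
  ((measurable_snd.pow_const a).aestronglyMeasurable.smul hF).mono_ac
    (weightedMeasure_absolutelyContinuous m)

lemma normLpm_yPow_add_le (hp : 1 < p) {F G : Pt N → 𝕜}
    (hF : AEStronglyMeasurable F (volume.restrict (halfSpace N)))
    (hG : AEStronglyMeasurable G (volume.restrict (halfSpace N))) :
    normLpm p m (yPow a (F + G)) ≤ normLpm p m (yPow a F) + normLpm p m (yPow a G) := by
  have e : yPow a (F + G) = yPow a F + yPow a G := by
    funext z; simp [yPow, smul_add]
  rw [e]
  exact eLpNorm_add_le (aestronglyMeasurable_yPow hF m a) (aestronglyMeasurable_yPow hG m a)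
    (by simpa using hp.le)

lemma normLpm_yPow_le {E : Type*} [RCLike E] {b c : ℝ} {F : Pt N → 𝕜} {G : Pt N → E}
    (h : ∀ z ∈ halfSpace N, z.2 ^ a * ‖F z‖ ≤ c * (z.2 ^ b * ‖G z‖)) :
    normLpm p m (yPow a F) ≤ ENNReal.ofReal c * normLpm p m (yPow b G) := by
  refine eLpNorm_le_mul_eLpNorm_of_ae_le_mul (ae_weightedMeasure_of_halfSpace fun z hz => ?_) _
  have hz0 : 0 < z.2 := hz
  simpa [yPow, norm_smul, abs_of_nonneg (Real.rpow_nonneg hz0.le _)] using h z hz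

lemma normLpm_congr {F G : Pt N → 𝕜} (h : F =ᵐ[volume.restrict (halfSpace N)] G) :
    normLpm p m (yPow a F) = normLpm p m (yPow a G) := by
  refine eLpNorm_congr_ae ?_
  filter_upwards [(weightedMeasure_absolutelyContinuous m).ae_le h] with z hz
  simp [yPow, hz]

lemma rpow_le_two_rpow_mul {s y : ℝ} (hs : 0 < s) (hy : 0 < y) (h1 : y ≤ 2 * s) (h2 : s ≤ 2 * y)
    (q : ℝ) : y ^ q ≤ 2 ^ |q| * s ^ q := by
  rcases le_total 0 q with hq | hq
  · rw [abs_of_nonneg hq, ← Real.mul_rpow (by norm_num) hs.le]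
    exact Real.rpow_le_rpow hy.le h1 hq
  · rw [abs_of_nonpos hq]
    have h3 : (2 * y) ^ q ≤ s ^ q := Real.rpow_le_rpow_of_nonpos hs h2 hq
    rw [Real.mul_rpow (by norm_num) hy.le] at h3
    rw [Real.rpow_neg (by norm_num)]
    have : (0 : ℝ) < 2 ^ q := by positivity
    rw [inv_mul_eq_div, le_div_iff₀ this]
    linarith

/-- If `F` is bounded, for `y ∈ J`, by the mean of `‖V‖` in `y` over `[1/r, 2/r]` and vanishes
elsewhere, its weighted norm is controlled by that of `V` on the strip `1/r ≤ y ≤ 2/r`, as soon as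
the mass of the weight on `J` is comparable to that on the strip. -/
lemma normLpm_yPow_le_of_mean {p m a : ℝ} (hp : 1 < p) {r : ℝ} (hr : 0 < r) {J : Set ℝ}
    (hJ : MeasurableSet J) {C c : ℝ≥0∞}
    (hC : ∀ s ∈ Icc (1 / r) (2 / r), ENNReal.ofReal r * ∫⁻ y in J, ENNReal.ofReal (y ^ (a * p + m)) ≤
      C * ENNReal.ofReal (s ^ (a * p + m)))
    {F V : Pt N → 𝕜} (hV : Continuous V)
    (hF : ∀ z ∈ halfSpace N, ‖F z‖ₑ ≤ J.indicator (fun _ => c * (ENNReal.ofReal r *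
      ∫⁻ s in Icc (1 / r) (2 / r), ‖V (z.1, s)‖ₑ)) z.2) :
    normLpm p m (yPow a F) ≤
      c * C ^ (1 / p) * normLpm p m (yPow a ((strip N (1 / r) (2 / r)).indicator V)) := by
  have hp0 : 0 < p := by linarith
  set q := a * p + m with hq
  set I := Icc (1 / r) (2 / r) with hI
  have hI0 : ∀ s ∈ I, 0 < s := fun s hs => lt_of_lt_of_le (by positivity) hs.1
  have hvol : volume I = ENNReal.ofReal (1 / r) := by
    rw [hI, Real.volume_Icc]; congr 1; field_simp; norm_num
  set A : EuclideanSpace ℝ (Fin N) → ℝ≥0∞ := fun x => ∫⁻ s in I, ‖V (x, s)‖ₑ with hA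
  have hAm : Measurable A := (hV.enorm.measurable).lintegral_prod_right'
  have hA2m : Measurable fun x => ∫⁻ s in I, ‖V (x, s)‖ₑ ^ p :=
    (hV.enorm.measurable.pow_const p).lintegral_prod_right'
  have hAp : ∀ x, (ENNReal.ofReal r * A x) ^ p ≤
      ENNReal.ofReal r * ∫⁻ s in I, ‖V (x, s)‖ₑ ^ p := by
    intro x
    have hm : AEMeasurable (fun s => ‖V (x, s)‖ₑ) (volume.restrict I) :=
      (hV.comp (Continuous.prodMk_right x)).enorm.measurable.aemeasurable
    calc (ENNReal.ofReal r * A x) ^ p = ENNReal.ofReal r ^ p * A x ^ p :=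
          ENNReal.mul_rpow_of_nonneg _ _ hp0.le
      _ ≤ ENNReal.ofReal r ^ p * (volume I ^ (p - 1) * ∫⁻ s in I, ‖V (x, s)‖ₑ ^ p) := by
          gcongr
          simpa using rpow_lintegral_le hp hm
      _ = ENNReal.ofReal r * ∫⁻ s in I, ‖V (x, s)‖ₑ ^ p := by
          rw [← mul_assoc]
          congr 1
          rw [hvol, ENNReal.ofReal_rpow_of_pos hr, ENNReal.ofReal_rpow_of_pos (by positivity),
            ← ENNReal.ofReal_mul (by positivity)]
          congr 1
          rw [one_div, Real.inv_rpow hr.le, ← Real.rpow_neg hr.le, ← Real.rpow_add hr]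
          simp
  have hlhs : normLpm p m (yPow a F) ^ p ≤ c ^ p *
      ((∫⁻ x, (ENNReal.ofReal r * A x) ^ p) * ∫⁻ y in J, ENNReal.ofReal (y ^ q)) := by
    rw [normLpm_yPow_rpow hp0]
    calc ∫⁻ z in halfSpace N, ENNReal.ofReal (z.2 ^ q) * ‖F z‖ₑ ^ p
        ≤ ∫⁻ z in halfSpace N, c ^ p * ((ENNReal.ofReal r * A z.1) ^ p *
            J.indicator (fun y => ENNReal.ofReal (y ^ q)) z.2) := by
          refine setLIntegral_mono' isOpen_halfSpace.measurableSet fun z hz => ?_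
          refine (mul_le_mul_right (ENNReal.rpow_le_rpow (hF z hz) hp0.le) _).trans ?_
          by_cases h : z.2 ∈ J
          · simp only [indicator_of_mem h]
            rw [ENNReal.mul_rpow_of_nonneg _ _ hp0.le, mul_comm, mul_assoc]
          · simp only [indicator_of_notMem h]
            rw [ENNReal.zero_rpow_of_pos hp0]; simp
      _ ≤ ∫⁻ z : Pt N, c ^ p * ((ENNReal.ofReal r * A z.1) ^ p *
            J.indicator (fun y => ENNReal.ofReal (y ^ q)) z.2) := setLIntegral_le_lintegral _ _
      _ = _ := by
          have hm1 : Measurable fun x => (ENNReal.ofReal r * A x) ^ p :=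
            (hAm.const_mul _).pow_const p
          have hm2 : Measurable (J.indicator fun y : ℝ => ENNReal.ofReal (y ^ q)) :=
            ((measurable_id.pow_const q).ennreal_ofReal).indicator hJ
          have hm3 : Measurable fun z : Pt N => (ENNReal.ofReal r * A z.1) ^ p *
              J.indicator (fun y => ENNReal.ofReal (y ^ q)) z.2 :=
            (hm1.comp measurable_fst).mul (hm2.comp measurable_snd)
          rw [lintegral_const_mul _ hm3]
          congr 1
          have := lintegral_prod_mul (μ := (volume : Measure (EuclideanSpace ℝ (Fin N))))
            (ν := (volume : Measure ℝ)) hm1.aemeasurable hm2.aemeasurable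
          rw [lintegral_indicator hJ] at this
          exact this
  have hrhs : normLpm p m (yPow a ((strip N (1 / r) (2 / r)).indicator V)) ^ p =
      ∫⁻ x, ∫⁻ s in I, ENNReal.ofReal (s ^ q) * ‖V (x, s)‖ₑ ^ p := by
    rw [normLpm_yPow_rpow hp0]
    have hm : Measurable fun z : Pt N =>
        I.indicator (fun y => ENNReal.ofReal (y ^ q)) z.2 * ‖V z‖ₑ ^ p :=
      ((((measurable_id.pow_const q).ennreal_ofReal).indicator measurableSet_Icc).comp
        measurable_snd).mul (hV.enorm.measurable.pow_const p)
    calc ∫⁻ z in halfSpace N, ENNReal.ofReal (z.2 ^ q) *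
          ‖(strip N (1 / r) (2 / r)).indicator V z‖ₑ ^ p
        = ∫⁻ z : Pt N, I.indicator (fun y => ENNReal.ofReal (y ^ q)) z.2 * ‖V z‖ₑ ^ p := by
          rw [← lintegral_indicator isOpen_halfSpace.measurableSet]
          congr 1
          funext z
          by_cases h : z.2 ∈ I
          · have h1 : z ∈ strip N (1 / r) (2 / r) := h
            have h2 : z ∈ halfSpace N := hI0 _ h
            rw [indicator_of_mem h2, indicator_of_mem h1, indicator_of_mem h]
          · have h1 : z ∉ strip N (1 / r) (2 / r) := h
            rw [indicator_of_notMem h, zero_mul, Set.indicator, indicator_of_notMem h1]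
            simp [hp0]
      _ = ∫⁻ x, ∫⁻ y, I.indicator (fun y => ENNReal.ofReal (y ^ q)) y * ‖V (x, y)‖ₑ ^ p :=
          lintegral_prod _ hm.aemeasurable
      _ = _ := by
          refine lintegral_congr fun x => ?_
          have hIm : MeasurableSet I := measurableSet_Icc
          rw [← lintegral_indicator hIm]
          congr 1
          funext s
          by_cases h : s ∈ I
          · simp only [indicator_of_mem h]
          · simp only [indicator_of_notMem h, zero_mul]
  rw [← ENNReal.rpow_le_rpow_iff hp0]
  refine hlhs.trans ?_
  rw [ENNReal.mul_rpow_of_nonneg _ _ hp0.le, ENNReal.mul_rpow_of_nonneg _ _ hp0.le,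
    ← ENNReal.rpow_mul, one_div_mul_cancel hp0.ne', ENNReal.rpow_one, hrhs, mul_assoc]
  refine mul_le_mul_right ?_ _
  set D := ∫⁻ y in J, ENNReal.ofReal (y ^ q) with hD
  have hVm : Measurable fun z : Pt N => ‖V z‖ₑ ^ p := hV.enorm.measurable.pow_const p
  have hVx : ∀ x, Measurable fun s => ‖V (x, s)‖ₑ ^ p := fun x =>
    hVm.comp measurable_prodMk_left
  calc (∫⁻ x, (ENNReal.ofReal r * A x) ^ p) * D
      ≤ (∫⁻ x, ENNReal.ofReal r * ∫⁻ s in I, ‖V (x, s)‖ₑ ^ p) * D := by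
        gcongr with x
        exact hAp x
    _ = ∫⁻ x, ∫⁻ s in I, (ENNReal.ofReal r * D) * ‖V (x, s)‖ₑ ^ p := by
        rw [← lintegral_mul_const _ (hA2m.const_mul _)]
        refine lintegral_congr fun x => ?_
        rw [lintegral_const_mul _ (hVx x)]
        ring
    _ ≤ ∫⁻ x, ∫⁻ s in I, C * (ENNReal.ofReal (s ^ q) * ‖V (x, s)‖ₑ ^ p) := by
        refine lintegral_mono fun x => setLIntegral_mono' measurableSet_Icc fun s hs => ?_
        rw [← mul_assoc]
        exact mul_le_mul_left (hC s hs) _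
    _ = C * ∫⁻ x, ∫⁻ s in I, ENNReal.ofReal (s ^ q) * ‖V (x, s)‖ₑ ^ p := by
        rw [← lintegral_const_mul]
        · refine lintegral_congr fun x => ?_
          rw [lintegral_const_mul]
          exact (measurable_id.pow_const q).ennreal_ofReal.mul (hVx x)
        · exact ((measurable_weight q).mul hVm).lintegral_prod_right'

lemma lintegral_weight_Icc_le {r : ℝ} (hr : 0 < r) (q : ℝ) {s : ℝ} (hs : s ∈ Icc (1 / r) (2 / r)) :
    ENNReal.ofReal r * ∫⁻ y in Icc (1 / r) (2 / r), ENNReal.ofReal (y ^ q) ≤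
      ENNReal.ofReal (2 ^ |q|) * ENNReal.ofReal (s ^ q) := by
  have h0 : 0 < 1 / r := by positivity
  have h12 : 2 / r = 2 * (1 / r) := by ring
  have hs0 : 0 < s := h0.trans_le hs.1
  have hvol : volume (Icc (1 / r) (2 / r)) = ENNReal.ofReal (1 / r) := by
    rw [Real.volume_Icc]; congr 1; field_simp; norm_num
  calc ENNReal.ofReal r * ∫⁻ y in Icc (1 / r) (2 / r), ENNReal.ofReal (y ^ q)
      ≤ ENNReal.ofReal r * ∫⁻ y in Icc (1 / r) (2 / r), ENNReal.ofReal (2 ^ |q| * s ^ q) := by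
        refine mul_le_mul_right (setLIntegral_mono' measurableSet_Icc fun y hy =>
          ENNReal.ofReal_le_ofReal ?_) _
        refine rpow_le_two_rpow_mul hs0 (h0.trans_le hy.1) ?_ ?_ q
        · linarith [hy.2, hs.1]
        · linarith [hs.2, hy.1]
    _ = _ := by
        rw [setLIntegral_const, hvol, ← ENNReal.ofReal_mul (by positivity),
          ← ENNReal.ofReal_mul (by positivity), ← ENNReal.ofReal_mul (by positivity)]
        congr 1
        field_simp

lemma lintegral_weight_Ioo_le {r : ℝ} (hr : 0 < r) {q : ℝ} (hq : -1 < q) {s : ℝ}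
    (hs : s ∈ Icc (1 / r) (2 / r)) :
    ENNReal.ofReal r * ∫⁻ y in Ioo 0 (2 / r), ENNReal.ofReal (y ^ q) ≤
      ENNReal.ofReal (2 / (q + 1) * 2 ^ |q|) * ENNReal.ofReal (s ^ q) := by
  have h0 : 0 < 1 / r := by positivity
  have h12 : 2 / r = 2 * (1 / r) := by ring
  have hs0 : 0 < s := h0.trans_le hs.1
  have hr2 : 0 < 2 / r := by positivity
  have hq1 : 0 < q + 1 := by linarith
  have hint : IntegrableOn (fun y : ℝ => y ^ q) (Ioo 0 (2 / r)) :=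
    (intervalIntegral.integrableOn_Ioo_rpow_iff hr2).2 hq
  rw [← ofReal_integral_eq_lintegral_ofReal hint
    (ae_restrict_of_forall_mem measurableSet_Ioo fun y hy => Real.rpow_nonneg hy.1.le q),
    ← integral_Ioc_eq_integral_Ioo, ← intervalIntegral.integral_of_le hr2.le,
    integral_rpow (Or.inl hq), Real.zero_rpow hq1.ne', sub_zero,
    ← ENNReal.ofReal_mul hr.le, ← ENNReal.ofReal_mul (by positivity)]
  refine ENNReal.ofReal_le_ofReal ?_
  rw [Real.rpow_add_one hr2.ne']
  have : (2 / r) ^ q ≤ 2 ^ |q| * s ^ q :=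
    rpow_le_two_rpow_mul hs0 hr2 (by linarith [hs.1]) (by linarith [hs.2]) q
  calc r * ((2 / r) ^ q * (2 / r) / (q + 1)) = 2 / (q + 1) * (2 / r) ^ q := by field_simp
    _ ≤ 2 / (q + 1) * (2 ^ |q| * s ^ q) := by gcongr
    _ = _ := by ring

end Weighted

/-! ### Estimates for the regularized approximation -/

section Estimates
variable {N : ℕ} {𝕜 : Type*} [RCLike 𝕜]

variable (N) in
/-- The region close to the boundary or to infinity, `y ≤ 2/r` or `y ≥ r`. -/
def tailSet (r : ℝ) : Set (Pt N) := {z | z.2 ≤ 2 / r ∨ r ≤ z.2}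

lemma measurableSet_tailSet (r : ℝ) : MeasurableSet (tailSet N r) :=
  (measurableSet_le measurable_snd measurable_const).union
    (measurableSet_le measurable_const measurable_snd)

/-- The error of an approximation `V` of `U` on the strip `1/r ≤ y ≤ 2r`, increased by the norm of
`U` outside the slightly smaller strip. -/
def approxError (p m a r : ℝ) (U V : Pt N → 𝕜) : ℝ≥0∞ :=
  normLpm p m (yPow a ((tailSet N r).indicator U)) +
    normLpm p m (yPow a ((strip N (1 / r) (2 * r)).indicator (U - V)))

variable {p m a r : ℝ} {U V : Pt N → 𝕜}

lemma normLpm_yPow_le_approxError (hp : 1 < p)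
    (hU : AEStronglyMeasurable U (volume.restrict (halfSpace N))) (hV : Continuous V)
    {E : Set (Pt N)} (hE : MeasurableSet E) (h1 : E ⊆ tailSet N r)
    (h2 : E ⊆ strip N (1 / r) (2 * r)) :
    normLpm p m (yPow a (E.indicator V)) ≤ approxError p m a r U V := by
  have e : E.indicator V = E.indicator U + -(E.indicator (U - V)) := by
    rw [indicator_sub', neg_sub, add_sub_cancel]
  have hVm : AEStronglyMeasurable V (volume.restrict (halfSpace N)) := hV.aestronglyMeasurable
  rw [e]
  refine (normLpm_yPow_add_le hp (hU.indicator hE) ((hU.sub hVm).indicator hE).neg).trans ?_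
  refine add_le_add ?_ ?_
  · rw [← one_mul (normLpm p m (yPow a ((tailSet N r).indicator U))), ← ENNReal.ofReal_one]
    refine normLpm_yPow_le fun z hz => ?_
    rw [one_mul]
    exact mul_le_mul_of_nonneg_left (norm_indicator_le_of_subset h1 U z) (Real.rpow_nonneg (le_of_lt hz) a)
  · rw [← one_mul (normLpm p m (yPow a ((strip N (1 / r) (2 * r)).indicator (U - V)))),
      ← ENNReal.ofReal_one]
    refine normLpm_yPow_le fun z hz => ?_
    rw [one_mul, Pi.neg_apply, norm_neg]
    exact mul_le_mul_of_nonneg_left (norm_indicator_le_of_subset h2 (U - V) z)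
      (Real.rpow_nonneg (le_of_lt hz) a)

lemma strip_low_subset (hr : 1 ≤ r) :
    strip N (1 / r) (2 / r) ⊆ tailSet N r ∧ strip N (1 / r) (2 / r) ⊆ strip N (1 / r) (2 * r) := by
  have hr0 : 0 < r := by linarith
  have : 2 / r ≤ 2 * r := by rw [div_le_iff₀ hr0]; nlinarith
  exact ⟨fun z hz => Or.inl hz.2, fun z hz => ⟨hz.1, hz.2.trans this⟩⟩

lemma strip_high_subset (hr : 1 ≤ r) :
    strip N r (2 * r) ⊆ tailSet N r ∧ strip N r (2 * r) ⊆ strip N (1 / r) (2 * r) := by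
  have hr0 : 0 < r := by linarith
  have : 1 / r ≤ r := by rw [div_le_iff₀ hr0]; nlinarith
  exact ⟨fun z hz => Or.inr hz.1, fun z hz => ⟨this.trans hz.1, hz.2⟩⟩

/-- The part of the error not coming from the means: outside the region where the cutoff factor is
`1` the function `U` itself is small, elsewhere `U - V` is. -/
lemma normLpm_yPow_cutoff_le (hp : 1 < p) (hr : 1 ≤ r)
    (hU : AEStronglyMeasurable U (volume.restrict (halfSpace N))) (hV : Continuous V) :
    normLpm p m (yPow a fun z => U z - (cutoff (z.2 / r) - cutoff (r * z.2)) • V z) ≤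
      2 * approxError p m a r U V := by
  have hr0 : 0 < r := by linarith
  have hVm : AEStronglyMeasurable V (volume.restrict (halfSpace N)) := hV.aestronglyMeasurable
  have hc : Continuous fun z : Pt N => cutoff (z.2 / r) - cutoff (r * z.2) :=
    (contDiff_cutoff.continuous.comp (continuous_snd.div_const r)).sub
      (contDiff_cutoff.continuous.comp (continuous_const.mul continuous_snd))
  have e : (fun z => U z - (cutoff (z.2 / r) - cutoff (r * z.2)) • V z) =
      (fun z => (1 - (cutoff (z.2 / r) - cutoff (r * z.2))) • U z) +
      fun z => (cutoff (z.2 / r) - cutoff (r * z.2)) • (U - V) z := by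
    funext z
    simp only [Pi.add_apply, Pi.sub_apply, sub_smul, smul_sub, one_smul]
    abel
  rw [e]
  refine (normLpm_yPow_add_le hp ?_ ?_).trans ?_
  · exact (continuous_const.sub hc).aestronglyMeasurable.smul hU
  · exact hc.aestronglyMeasurable.smul (hU.sub hVm)
  have hb : ∀ t, 0 ≤ cutoff t ∧ cutoff t ≤ 1 := fun t => ⟨cutoff_nonneg t, cutoff_le_one t⟩
  have t1 : normLpm p m (yPow a fun z => (1 - (cutoff (z.2 / r) - cutoff (r * z.2))) • U z) ≤
      ENNReal.ofReal 2 * normLpm p m (yPow a ((tailSet N r).indicator U)) := by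
    refine normLpm_yPow_le fun z hz => ?_
    have hz0 : 0 < z.2 := hz
    by_cases h : z ∈ tailSet N r
    · rw [indicator_of_mem h, norm_smul, mul_left_comm 2]
      gcongr
      rw [Real.norm_eq_abs, abs_le]
      have := hb (z.2 / r)
      have := hb (r * z.2)
      constructor <;> linarith
    · simp only [tailSet, mem_ofPred_eq, not_or, not_le] at h
      have h1 : 2 ≤ r * z.2 := by have := h.1.le; rwa [div_le_iff₀ hr0, mul_comm] at this
      have h2 : z.2 / r ≤ 1 := (div_le_one hr0).2 h.2.le
      rw [cutoff_of_ge h1, cutoff_of_le h2]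
      simp only [sub_zero, sub_self, zero_smul, norm_zero, mul_zero]
      positivity
  have t2 : normLpm p m (yPow a fun z => (cutoff (z.2 / r) - cutoff (r * z.2)) • (U - V) z) ≤
      ENNReal.ofReal 1 *
        normLpm p m (yPow a ((strip N (1 / r) (2 * r)).indicator (U - V))) := by
    refine normLpm_yPow_le fun z hz => ?_
    have hz0 : 0 < z.2 := hz
    rw [one_mul]
    by_cases h : z ∈ strip N (1 / r) (2 * r)
    · rw [indicator_of_mem h, norm_smul]
      have : ‖cutoff (z.2 / r) - cutoff (r * z.2)‖ ≤ 1 := by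
        rw [Real.norm_eq_abs, abs_le]
        have := hb (z.2 / r)
        have := hb (r * z.2)
        constructor <;> linarith
      exact mul_le_mul_of_nonneg_left (mul_le_of_le_one_left (norm_nonneg _) this) (by positivity)
    · have hθ : cutoff (z.2 / r) - cutoff (r * z.2) = 0 := by
        have h' : z.2 < 1 / r ∨ 2 * r < z.2 := by
          by_contra hn
          push Not at hn
          exact h hn
        rcases h' with h' | h'
        · have h1 : r * z.2 ≤ 1 := by have := h'.le; rwa [le_div_iff₀ hr0, mul_comm] at this
          have h2 : z.2 / r ≤ 1 := by
            rw [div_le_one hr0]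
            nlinarith
          rw [cutoff_of_le h1, cutoff_of_le h2, sub_self]
        · have h1 : 2 ≤ z.2 / r := by rw [le_div_iff₀ hr0]; exact h'.le
          have h2 : 2 ≤ r * z.2 := by nlinarith
          rw [cutoff_of_ge h1, cutoff_of_ge h2, sub_self]
      rw [hθ]
      simp only [zero_smul, norm_zero, mul_zero]
      positivity
  refine (add_le_add t1 t2).trans ?_
  simp only [ENNReal.ofReal_one, ENNReal.ofReal_ofNat, approxError, mul_add]
  gcongr
  norm_num

/-- The regularization approximates tangential derivatives. The condition `-1 < ap + m` is what
allows to replace a function near the boundary by its mean. -/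
lemma exists_normLpm_sub_regularized_le (hp : 1 < p) (ha : -1 < a * p + m) :
    ∃ K : ℝ≥0∞, K ≠ ⊤ ∧ ∀ r : ℝ, 1 ≤ r → ∀ U V W : Pt N → 𝕜,
      AEStronglyMeasurable U (volume.restrict (halfSpace N)) → Continuous V → Continuous W →
      (∀ z, W z = (cutoff (z.2 / r) - cutoff (r * z.2)) • V z + cutoff (r * z.2) • meanY r V z) →
      normLpm p m (yPow a (U - W)) ≤ K * approxError p m a r U V := by
  set C := ENNReal.ofReal (2 / (a * p + m + 1) * 2 ^ |a * p + m|) with hC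
  refine ⟨2 + C ^ (1 / p), ?_, fun r hr U V W hU hV hWc hW => ?_⟩
  · exact ENNReal.add_ne_top.2 ⟨by simp, ENNReal.rpow_ne_top_of_nonneg
      (by positivity) ENNReal.ofReal_ne_top⟩
  have hr0 : 0 < r := by linarith
  have hc : Continuous fun z : Pt N => cutoff (z.2 / r) - cutoff (r * z.2) :=
    (contDiff_cutoff.continuous.comp (continuous_snd.div_const r)).sub
      (contDiff_cutoff.continuous.comp (continuous_const.mul continuous_snd))
  have e : U - W = (fun z => U z - (cutoff (z.2 / r) - cutoff (r * z.2)) • V z) +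
      fun z => -(cutoff (r * z.2) • meanY r V z) := by
    funext z
    simp only [Pi.sub_apply, Pi.add_apply, hW]
    abel
  have e2 : (fun z => -(cutoff (r * z.2) • meanY r V z)) =
      fun z => (cutoff (z.2 / r) - cutoff (r * z.2)) • V z - W z := by
    funext z
    rw [hW]
    abel
  rw [e, add_mul]
  refine (normLpm_yPow_add_le hp ?_ ?_).trans (add_le_add ?_ ?_)
  · exact hU.sub (hc.smul hV).aestronglyMeasurable
  · rw [e2]
    exact ((hc.smul hV).sub hWc).aestronglyMeasurable
  · exact normLpm_yPow_cutoff_le hp hr hU hV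
  · have h1 := normLpm_yPow_le_of_mean (a := a) (m := m) hp hr0 measurableSet_Ioo (c := 1)
      (fun s hs => lintegral_weight_Ioo_le hr0 ha hs)
      (F := fun z => -(cutoff (r * z.2) • meanY r V z)) hV fun z hz => by
        have hz0 : 0 < z.2 := hz
        rw [enorm_neg]
        by_cases h : z.2 ∈ Ioo 0 (2 / r)
        · rw [indicator_of_mem h, one_mul, enorm_smul]
          refine (mul_le_of_le_one_left' ?_).trans (enorm_mean_le hr0 _)
          rw [Real.enorm_eq_ofReal (cutoff_nonneg _)]
          exact ENNReal.ofReal_le_one.2 (cutoff_le_one _)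
        · have : 2 ≤ r * z.2 := by
            by_contra hn
            exact h ⟨hz0, by rw [lt_div_iff₀ hr0, mul_comm]; exact not_le.1 hn⟩
          rw [cutoff_of_ge this]
          simp
    rw [one_mul] at h1
    refine h1.trans ?_
    gcongr
    exact normLpm_yPow_le_approxError hp hU hV (measurableSet_strip _ _) (strip_low_subset hr).1
      (strip_low_subset hr).2

/-- The terms with derivatives of the lower cutoff: by the Poincaré inequality `V₀` is replaced by
`V₁ = D_y V₀`. -/
lemma normLpm_yPow_poincare_le (hp : 1 < p) (hr : 1 ≤ r) {c : ℝ} (hc : 0 ≤ c) {ψ : ℝ → ℝ}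
    (hψ : ∀ y ∈ Icc (1 / r) (2 / r), |ψ y| ≤ c * r) (hψ0 : ∀ y ∉ Icc (1 / r) (2 / r), ψ y = 0)
    {U₁ V₀ V₁ : Pt N → 𝕜} (hU₁ : AEStronglyMeasurable U₁ (volume.restrict (halfSpace N)))
    (hV₁ : Continuous V₁)
    (hV : ∀ z ∈ strip N (1 / r) (2 / r),
      ‖V₀ z - meanY r V₀ z‖ₑ ≤ ∫⁻ s in Icc (1 / r) (2 / r), ‖V₁ (z.1, s)‖ₑ) :
    normLpm p m (yPow a fun z => ψ z.2 • (V₀ z - meanY r V₀ z)) ≤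
      ENNReal.ofReal c * ENNReal.ofReal (2 ^ |a * p + m|) ^ (1 / p) *
        approxError p m a r U₁ V₁ := by
  have hr0 : 0 < r := by linarith
  refine (normLpm_yPow_le_of_mean (a := a) (m := m) hp hr0 measurableSet_Icc (c := ENNReal.ofReal c)
      (fun s hs => lintegral_weight_Icc_le hr0 _ hs) hV₁ fun z hz => ?_).trans ?_
  · by_cases h : z.2 ∈ Icc (1 / r) (2 / r)
    · rw [indicator_of_mem h, enorm_smul, ← mul_assoc, ← ENNReal.ofReal_mul hc]
      gcongr
      · rw [← ofReal_norm]
        exact ENNReal.ofReal_le_ofReal (hψ _ h)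
      · exact hV z h
    · rw [hψ0 _ h]
      simp
  · gcongr
    exact normLpm_yPow_le_approxError hp hU₁ hV₁ (measurableSet_strip _ _) (strip_low_subset hr).1
      (strip_low_subset hr).2

/-- A term with a factor of size `y^{b-a}` supported in `E`. -/
lemma normLpm_yPow_smul_le (hp : 1 < p) {b c : ℝ} (hc : 0 ≤ c) {ψ : ℝ → ℝ} {E : Set (Pt N)}
    (hE : MeasurableSet E) (h1 : E ⊆ tailSet N r) (h2 : E ⊆ strip N (1 / r) (2 * r))
    (hψ : ∀ z ∈ E, 0 < z.2 → z.2 ^ a * |ψ z.2| ≤ c * z.2 ^ b) (hψ0 : ∀ z ∉ E, ψ z.2 = 0)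
    (hU : AEStronglyMeasurable U (volume.restrict (halfSpace N))) (hV : Continuous V) :
    normLpm p m (yPow a fun z => ψ z.2 • V z) ≤
      ENNReal.ofReal c * approxError p m b r U V := by
  refine (normLpm_yPow_le (b := b) (c := c) (G := E.indicator V) fun z hz => ?_).trans ?_
  · have hz0 : 0 < z.2 := hz
    by_cases h : z ∈ E
    · rw [indicator_of_mem h, norm_smul, ← mul_assoc, ← mul_assoc]
      exact mul_le_mul_of_nonneg_right (hψ z h hz0) (norm_nonneg _)
    · rw [hψ0 z h]
      simp only [zero_smul, norm_zero, mul_zero]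
      positivity
  · gcongr
    exact normLpm_yPow_le_approxError hp hU hV hE h1 h2

end Estimates

section NormalEstimates
variable {N : ℕ} {𝕜 : Type*} [RCLike 𝕜] {p m a r : ℝ}

lemma mul_notMem_Icc_of_notMem {y : ℝ} (hr : 0 < r) (h : y ∉ Icc (1 / r) (2 / r)) :
    r * y ∉ Icc (1 : ℝ) 2 := fun hy =>
  h ⟨by rw [div_le_iff₀ hr, mul_comm]; exact hy.1, by rw [le_div_iff₀ hr, mul_comm]; exact hy.2⟩

lemma div_notMem_Icc_of_notMem {z : Pt N} (hr : 0 < r) (h : z ∉ strip N r (2 * r)) :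
    z.2 / r ∉ Icc (1 : ℝ) 2 := fun hy =>
  h ⟨by have := hy.1; rwa [one_le_div hr] at this, (div_le_iff₀ hr).1 hy.2⟩

/-- The regularization approximates the normal derivative. -/
lemma exists_normLpm_sub_regularized_deriv_le (hp : 1 < p) (ha : a ≤ 1) :
    ∃ K : ℝ≥0∞, K ≠ ⊤ ∧ ∀ r : ℝ, 1 ≤ r → ∀ U₀ U₁ V₀ V₁ W : Pt N → 𝕜,
      AEStronglyMeasurable U₀ (volume.restrict (halfSpace N)) →
      AEStronglyMeasurable U₁ (volume.restrict (halfSpace N)) →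
      Continuous V₀ → Continuous V₁ → Continuous (meanY r V₀) →
      (∀ z ∈ strip N (1 / r) (2 / r),
        ‖V₀ z - meanY r V₀ z‖ₑ ≤ ∫⁻ s in Icc (1 / r) (2 / r), ‖V₁ (z.1, s)‖ₑ) →
      (∀ z, W z = (cutoff (z.2 / r) - cutoff (r * z.2)) • V₁ z +
        (r⁻¹ * deriv cutoff (z.2 / r)) • V₀ z -
        (r * deriv cutoff (r * z.2)) • (V₀ z - meanY r V₀ z)) →
      normLpm p m (yPow a (U₁ - W)) ≤
        K * (approxError p m a r U₁ V₁ + approxError p m 0 r U₀ V₀) := by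
  obtain ⟨C, hC0, hC, -⟩ := exists_deriv_cutoff_le
  set Q := ENNReal.ofReal (2 ^ |a * p + m|) ^ (1 / p) with hQ
  have hQt : Q ≠ ⊤ := ENNReal.rpow_ne_top_of_nonneg (by positivity) ENNReal.ofReal_ne_top
  refine ⟨2 + ENNReal.ofReal (2 * C) + ENNReal.ofReal C * Q, by finiteness,
    fun r hr U₀ U₁ V₀ V₁ W hU₀ hU₁ hV₀ hV₁ hM hP hW => ?_⟩
  have hr0 : 0 < r := by linarith
  have hc1 : Continuous fun z : Pt N => cutoff (z.2 / r) - cutoff (r * z.2) :=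
    (contDiff_cutoff.continuous.comp (continuous_snd.div_const r)).sub
      (contDiff_cutoff.continuous.comp (continuous_const.mul continuous_snd))
  have hc2 : Continuous fun z : Pt N => -(r⁻¹ * deriv cutoff (z.2 / r)) :=
    (continuous_const.mul
      (contDiff_deriv_cutoff.continuous.comp (continuous_snd.div_const r))).neg
  have hc3 : Continuous fun z : Pt N => r * deriv cutoff (r * z.2) :=
    continuous_const.mul (contDiff_deriv_cutoff.continuous.comp (continuous_const.mul continuous_snd))
  have e : U₁ - W = (fun z => U₁ z - (cutoff (z.2 / r) - cutoff (r * z.2)) • V₁ z) +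
      (fun z => (-(r⁻¹ * deriv cutoff (z.2 / r))) • V₀ z) +
      fun z => (r * deriv cutoff (r * z.2)) • (V₀ z - meanY r V₀ z) := by
    funext z
    simp only [Pi.sub_apply, Pi.add_apply, hW, neg_smul]
    abel
  have m1 : AEStronglyMeasurable (fun z => U₁ z - (cutoff (z.2 / r) - cutoff (r * z.2)) • V₁ z)
      (volume.restrict (halfSpace N)) := hU₁.sub (hc1.smul hV₁).aestronglyMeasurable
  have m2 : AEStronglyMeasurable (fun z => (-(r⁻¹ * deriv cutoff (z.2 / r))) • V₀ z)
      (volume.restrict (halfSpace N)) := (hc2.smul hV₀).aestronglyMeasurable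
  have m3 : AEStronglyMeasurable
      (fun z => (r * deriv cutoff (r * z.2)) • (V₀ z - meanY r V₀ z))
      (volume.restrict (halfSpace N)) := (hc3.smul (hV₀.sub hM)).aestronglyMeasurable
  have t1 := normLpm_yPow_cutoff_le (a := a) (m := m) hp hr hU₁ hV₁
  have t2 : normLpm p m (yPow a fun z => (-(r⁻¹ * deriv cutoff (z.2 / r))) • V₀ z) ≤
      ENNReal.ofReal (2 * C) * approxError p m 0 r U₀ V₀ := by
    refine normLpm_yPow_smul_le hp (by positivity)
      (ψ := fun y => -(r⁻¹ * deriv cutoff (y / r))) (measurableSet_strip r (2 * r))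
      (strip_high_subset hr).1 (strip_high_subset hr).2 (fun z hz hz0 => ?_) (fun z hz => ?_) hU₀ hV₀
    · rw [Real.rpow_zero, mul_one, abs_neg, abs_mul, abs_of_pos (inv_pos.2 hr0)]
      have h1 : z.2 ^ a ≤ z.2 := by
        simpa using Real.rpow_le_rpow_of_exponent_le (hr.trans hz.1) ha
      have h2 : z.2 * r⁻¹ ≤ 2 := by
        rw [← div_eq_mul_inv, div_le_iff₀ hr0]; exact hz.2
      calc z.2 ^ a * (r⁻¹ * |deriv cutoff (z.2 / r)|) ≤ z.2 * (r⁻¹ * C) := by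
            gcongr
            exact hC _
        _ = z.2 * r⁻¹ * C := by ring
        _ ≤ 2 * C := by gcongr
    · rw [deriv_cutoff_of_notMem (div_notMem_Icc_of_notMem hr0 hz), mul_zero, neg_zero]
  have t3 : normLpm p m (yPow a fun z => (r * deriv cutoff (r * z.2)) • (V₀ z - meanY r V₀ z)) ≤
      ENNReal.ofReal C * Q * approxError p m a r U₁ V₁ := by
    refine normLpm_yPow_poincare_le hp hr hC0 (ψ := fun y => r * deriv cutoff (r * y))
      (fun y _ => ?_) (fun y hy => ?_) hU₁ hV₁ hP
    · rw [abs_mul, abs_of_pos hr0, mul_comm]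
      gcongr
      exact hC _
    · rw [deriv_cutoff_of_notMem (mul_notMem_Icc_of_notMem hr0 hy), mul_zero]
  rw [e]
  refine (normLpm_yPow_add_le hp (m1.add m2) m3).trans ((add_le_add
    ((normLpm_yPow_add_le hp m1 m2).trans (add_le_add t1 t2)) t3).trans ?_)
  rw [add_mul, add_mul]
  gcongr
  · exact le_self_add
  · exact le_add_self
  · exact le_self_add

/-- The regularization approximates the second normal derivative. -/
lemma exists_normLpm_sub_regularized_deriv_deriv_le (hp : 1 < p) (ha : a ≤ 2) :
    ∃ K : ℝ≥0∞, K ≠ ⊤ ∧ ∀ r : ℝ, 1 ≤ r → ∀ U₀ U₁ U₂ V₀ V₁ V₂ W : Pt N → 𝕜,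
      AEStronglyMeasurable U₀ (volume.restrict (halfSpace N)) →
      AEStronglyMeasurable U₁ (volume.restrict (halfSpace N)) →
      AEStronglyMeasurable U₂ (volume.restrict (halfSpace N)) →
      Continuous V₀ → Continuous V₁ → Continuous V₂ → Continuous (meanY r V₀) →
      (∀ z ∈ strip N (1 / r) (2 / r),
        ‖V₀ z - meanY r V₀ z‖ₑ ≤ ∫⁻ s in Icc (1 / r) (2 / r), ‖V₁ (z.1, s)‖ₑ) →
      (∀ z, W z = (cutoff (z.2 / r) - cutoff (r * z.2)) • V₂ z +
        (2 * (r⁻¹ * deriv cutoff (z.2 / r))) • V₁ z -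
        (2 * (r * deriv cutoff (r * z.2))) • V₁ z +
        (r⁻¹ ^ 2 * deriv (deriv cutoff) (z.2 / r)) • V₀ z -
        (r ^ 2 * deriv (deriv cutoff) (r * z.2)) • (V₀ z - meanY r V₀ z)) →
      normLpm p m (yPow a (U₂ - W)) ≤
        K * (approxError p m a r U₂ V₂ + approxError p m (a - 1) r U₁ V₁ +
          approxError p m 0 r U₀ V₀) := by
  obtain ⟨C, hC0, hC, hC'⟩ := exists_deriv_cutoff_le
  set Q := ENNReal.ofReal (2 ^ |(a - 1) * p + m|) ^ (1 / p) with hQ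
  have hQt : Q ≠ ⊤ := ENNReal.rpow_ne_top_of_nonneg (by positivity) ENNReal.ofReal_ne_top
  set k := ENNReal.ofReal (4 * C) with hk
  refine ⟨2 + k + k + k + ENNReal.ofReal 2 * (ENNReal.ofReal C * Q), by finiteness,
    fun r hr U₀ U₁ U₂ V₀ V₁ V₂ W hU₀ hU₁ hU₂ hV₀ hV₁ hV₂ hM hP hW => ?_⟩
  have hr0 : 0 < r := by linarith
  have hd : Continuous fun z : Pt N => z.2 / r := continuous_snd.div_const r
  have hu : Continuous fun z : Pt N => r * z.2 := continuous_const.mul continuous_snd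
  have hc1 : Continuous fun z : Pt N => cutoff (z.2 / r) - cutoff (r * z.2) :=
    (contDiff_cutoff.continuous.comp hd).sub (contDiff_cutoff.continuous.comp hu)
  have hc2 : Continuous fun z : Pt N => -(2 * (r⁻¹ * deriv cutoff (z.2 / r))) :=
    (continuous_const.mul (continuous_const.mul (contDiff_deriv_cutoff.continuous.comp hd))).neg
  have hc3 : Continuous fun z : Pt N => 2 * (r * deriv cutoff (r * z.2)) :=
    continuous_const.mul (continuous_const.mul (contDiff_deriv_cutoff.continuous.comp hu))
  have hc4 : Continuous fun z : Pt N => -(r⁻¹ ^ 2 * deriv (deriv cutoff) (z.2 / r)) :=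
    (continuous_const.mul (contDiff_deriv_deriv_cutoff.continuous.comp hd)).neg
  have hc5 : Continuous fun z : Pt N => r ^ 2 * deriv (deriv cutoff) (r * z.2) :=
    continuous_const.mul (contDiff_deriv_deriv_cutoff.continuous.comp hu)
  have e : U₂ - W = (fun z => U₂ z - (cutoff (z.2 / r) - cutoff (r * z.2)) • V₂ z) +
      (fun z => (-(2 * (r⁻¹ * deriv cutoff (z.2 / r)))) • V₁ z) +
      (fun z => (2 * (r * deriv cutoff (r * z.2))) • V₁ z) +
      (fun z => (-(r⁻¹ ^ 2 * deriv (deriv cutoff) (z.2 / r))) • V₀ z) +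
      fun z => (r ^ 2 * deriv (deriv cutoff) (r * z.2)) • (V₀ z - meanY r V₀ z) := by
    funext z
    simp only [Pi.sub_apply, Pi.add_apply, hW, neg_smul]
    abel
  have m1 : AEStronglyMeasurable (fun z => U₂ z - (cutoff (z.2 / r) - cutoff (r * z.2)) • V₂ z)
      (volume.restrict (halfSpace N)) := hU₂.sub (hc1.smul hV₂).aestronglyMeasurable
  have m2 : AEStronglyMeasurable (fun z => (-(2 * (r⁻¹ * deriv cutoff (z.2 / r)))) • V₁ z)
      (volume.restrict (halfSpace N)) := (hc2.smul hV₁).aestronglyMeasurable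
  have m3 : AEStronglyMeasurable (fun z => (2 * (r * deriv cutoff (r * z.2))) • V₁ z)
      (volume.restrict (halfSpace N)) := (hc3.smul hV₁).aestronglyMeasurable
  have m4 : AEStronglyMeasurable (fun z => (-(r⁻¹ ^ 2 * deriv (deriv cutoff) (z.2 / r))) • V₀ z)
      (volume.restrict (halfSpace N)) := (hc4.smul hV₀).aestronglyMeasurable
  have m5 : AEStronglyMeasurable
      (fun z => (r ^ 2 * deriv (deriv cutoff) (r * z.2)) • (V₀ z - meanY r V₀ z))
      (volume.restrict (halfSpace N)) := (hc5.smul (hV₀.sub hM)).aestronglyMeasurable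
  have hinv : ∀ z ∈ strip N r (2 * r), 0 < z.2 → r⁻¹ ≤ 2 * z.2⁻¹ := by
    intro z hz hz0
    rw [← div_eq_mul_inv, le_div_iff₀ hz0, mul_comm, ← div_eq_mul_inv, div_le_iff₀ hr0]
    exact hz.2
  have t1 := normLpm_yPow_cutoff_le (a := a) (m := m) hp hr hU₂ hV₂
  have t2 : normLpm p m (yPow a fun z => (-(2 * (r⁻¹ * deriv cutoff (z.2 / r)))) • V₁ z) ≤
      k * approxError p m (a - 1) r U₁ V₁ := by
    refine normLpm_yPow_smul_le hp (by positivity)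
      (ψ := fun y => -(2 * (r⁻¹ * deriv cutoff (y / r)))) (measurableSet_strip r (2 * r))
      (strip_high_subset hr).1 (strip_high_subset hr).2 (fun z hz hz0 => ?_) (fun z hz => ?_) hU₁ hV₁
    · rw [abs_neg, abs_mul, abs_mul, abs_of_pos (inv_pos.2 hr0), abs_two, Real.rpow_sub_one hz0.ne']
      calc z.2 ^ a * (2 * (r⁻¹ * |deriv cutoff (z.2 / r)|))
          ≤ z.2 ^ a * (2 * ((2 * z.2⁻¹) * C)) := by
            gcongr
            · exact hinv z hz hz0
            · exact hC _
        _ = 4 * C * (z.2 ^ a / z.2) := by ring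
    · rw [deriv_cutoff_of_notMem (div_notMem_Icc_of_notMem hr0 hz), mul_zero, mul_zero, neg_zero]
  have t3 : normLpm p m (yPow a fun z => (2 * (r * deriv cutoff (r * z.2))) • V₁ z) ≤
      k * approxError p m (a - 1) r U₁ V₁ := by
    refine normLpm_yPow_smul_le hp (by positivity)
      (ψ := fun y => 2 * (r * deriv cutoff (r * y))) (measurableSet_strip (1 / r) (2 / r))
      (strip_low_subset hr).1 (strip_low_subset hr).2 (fun z hz hz0 => ?_) (fun z hz => ?_) hU₁ hV₁
    · rw [abs_mul, abs_mul, abs_of_pos hr0, abs_two, Real.rpow_sub_one hz0.ne']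
      have : r ≤ 2 * z.2⁻¹ := by
        rw [← div_eq_mul_inv, le_div_iff₀ hz0, mul_comm, ← le_div_iff₀ hr0]; exact hz.2
      calc z.2 ^ a * (2 * (r * |deriv cutoff (r * z.2)|))
          ≤ z.2 ^ a * (2 * ((2 * z.2⁻¹) * C)) := by
            gcongr
            exact hC _
        _ = 4 * C * (z.2 ^ a / z.2) := by ring
    · rw [deriv_cutoff_of_notMem (mul_notMem_Icc_of_notMem hr0 hz), mul_zero, mul_zero]
  have t4 : normLpm p m (yPow a fun z => (-(r⁻¹ ^ 2 * deriv (deriv cutoff) (z.2 / r))) • V₀ z) ≤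
      k * approxError p m 0 r U₀ V₀ := by
    refine normLpm_yPow_smul_le hp (by positivity)
      (ψ := fun y => -(r⁻¹ ^ 2 * deriv (deriv cutoff) (y / r))) (measurableSet_strip r (2 * r))
      (strip_high_subset hr).1 (strip_high_subset hr).2 (fun z hz hz0 => ?_) (fun z hz => ?_) hU₀ hV₀
    · rw [Real.rpow_zero, mul_one, abs_neg, abs_mul, abs_of_pos (by positivity)]
      have h1 : z.2 ^ a ≤ z.2 ^ 2 := by
        have := Real.rpow_le_rpow_of_exponent_le (hr.trans hz.1) ha
        simpa using this
      calc z.2 ^ a * (r⁻¹ ^ 2 * |deriv (deriv cutoff) (z.2 / r)|)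
          ≤ z.2 ^ 2 * ((2 * z.2⁻¹) ^ 2 * C) := by
            gcongr
            · exact hinv z hz hz0
            · exact hC' _
        _ = 4 * C := by field_simp; ring
    · rw [deriv_deriv_cutoff_of_notMem (div_notMem_Icc_of_notMem hr0 hz), mul_zero, neg_zero]
  have t5 : normLpm p m
      (yPow a fun z => (r ^ 2 * deriv (deriv cutoff) (r * z.2)) • (V₀ z - meanY r V₀ z)) ≤
      ENNReal.ofReal 2 * (ENNReal.ofReal C * Q) * approxError p m (a - 1) r U₁ V₁ := by
    refine (normLpm_yPow_le (b := a - 1) (c := 2)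
      (G := fun z => (r * deriv (deriv cutoff) (r * z.2)) • (V₀ z - meanY r V₀ z))
      fun z hz => ?_).trans ?_
    · have hz0 : 0 < z.2 := hz
      by_cases h : z.2 ∈ Icc (1 / r) (2 / r)
      · have h2 : r * z.2 ≤ 2 := by rw [mul_comm, ← le_div_iff₀ hr0]; exact h.2
        rw [norm_smul, norm_smul, norm_mul, norm_mul, Real.norm_of_nonneg hr0.le,
          Real.norm_of_nonneg (sq_nonneg r), Real.rpow_sub_one hz0.ne']
        calc z.2 ^ a * (r ^ 2 * ‖deriv (deriv cutoff) (r * z.2)‖ * ‖V₀ z - meanY r V₀ z‖)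
            = (r * z.2) * (z.2 ^ a / z.2 *
              (r * ‖deriv (deriv cutoff) (r * z.2)‖ * ‖V₀ z - meanY r V₀ z‖)) := by
              field_simp
          _ ≤ 2 * (z.2 ^ a / z.2 *
              (r * ‖deriv (deriv cutoff) (r * z.2)‖ * ‖V₀ z - meanY r V₀ z‖)) := by gcongr
      · rw [deriv_deriv_cutoff_of_notMem (mul_notMem_Icc_of_notMem hr0 h)]
        simp
    · rw [mul_assoc (ENNReal.ofReal 2)]
      refine mul_le_mul_right ?_ _
      refine normLpm_yPow_poincare_le hp hr hC0 (ψ := fun y => r * deriv (deriv cutoff) (r * y))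
        (fun y _ => ?_) (fun y hy => ?_) hU₁ hV₁ hP
      · rw [abs_mul, abs_of_pos hr0, mul_comm]
        gcongr
        exact hC' _
      · rw [deriv_deriv_cutoff_of_notMem (mul_notMem_Icc_of_notMem hr0 hy), mul_zero]
  rw [e]
  set E₂ := approxError p m a r U₂ V₂
  set E₁ := approxError p m (a - 1) r U₁ V₁
  set E₀ := approxError p m 0 r U₀ V₀
  have hE₂ : E₂ ≤ E₂ + E₁ + E₀ := le_self_add.trans le_self_add
  have hE₁ : E₁ ≤ E₂ + E₁ + E₀ := le_add_self.trans le_self_add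
  have hE₀ : E₀ ≤ E₂ + E₁ + E₀ := le_add_self
  refine (normLpm_yPow_add_le hp (((m1.add m2).add m3).add m4) m5).trans (le_trans (add_le_add
    ((normLpm_yPow_add_le hp ((m1.add m2).add m3) m4).trans (add_le_add
      ((normLpm_yPow_add_le hp (m1.add m2) m3).trans (add_le_add
        ((normLpm_yPow_add_le hp m1 m2).trans (add_le_add t1 t2)) t3)) t4)) t5) ?_)
  simp only [add_mul]
  gcongr

end NormalEstimates

/-! ### Tensor products belong to the space -/

section Membership
variable {N : ℕ} {𝕜 : Type*} [RCLike 𝕜] {p m a : ℝ}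

/-- A function in `𝒟` extends to a smooth function on the line, constant to the left. -/
lemma MemD.extend {v : ℝ → 𝕜} (hv : MemD v) : ContDiff ℝ ∞ (fun y => v (max y 0)) ∧
    (∃ R : ℝ, 0 < R ∧ ∀ y, R ≤ y → v (max y 0) = 0) ∧
    ∃ δ : ℝ, 0 < δ ∧ ∀ y < δ, v (max y 0) = v 0 := by
  obtain ⟨hc, ⟨R, hR⟩, δ, hδ, hd⟩ := hv
  have hconst : ∀ x ∈ Icc 0 δ, v x = v 0 := by
    have hdiff : DifferentiableOn ℝ v (Ici 0) := hc.differentiableOn (by simp)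
    refine constant_of_derivWithin_zero (hdiff.mono Icc_subset_Ici_self) fun x hx => ?_
    have h1 := (hdiff x hx.1).hasDerivWithinAt
    rw [hd x (Ico_subset_Icc_self hx)] at h1
    exact (h1.mono Icc_subset_Ici_self).derivWithin (uniqueDiffOn_Icc hδ x (Ico_subset_Icc_self hx))
  have hconst' : ∀ y < δ, v (max y 0) = v 0 := fun y hy =>
    hconst _ ⟨le_max_right _ _, max_le hy.le hδ.le⟩
  refine ⟨?_, ⟨max R 1, by positivity, fun y hy => hR _ ?_⟩, δ, hδ, hconst'⟩
  · rw [contDiff_iff_contDiffAt]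
    intro y
    rcases lt_or_ge y δ with h | h
    · refine (contDiffAt_const (c := v 0)).congr_of_eventuallyEq ?_
      filter_upwards [Iio_mem_nhds h] with s hs using hconst' s hs
    · have hy : 0 < y := hδ.trans_le h
      refine ((hc y hy.le).contDiffAt (Ici_mem_nhds hy)).congr_of_eventuallyEq ?_
      filter_upwards [Ioi_mem_nhds hy] with s hs
      rw [max_eq_left (le_of_lt hs)]
  · exact (le_max_left R 1).trans (hy.trans (le_max_left _ _))

lemma memLpm_yPow_mul (hp : 1 < p) {f : EuclideanSpace ℝ (Fin N) → 𝕜} {g : ℝ → 𝕜}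
    (hf : Continuous f) (hfc : HasCompactSupport f) (hg : Continuous g) {R : ℝ} (hR : 0 < R)
    (hgR : ∀ y, R ≤ y → g y = 0)
    (h : -1 < a * p + m ∨ ∃ δ : ℝ, 0 < δ ∧ ∀ y < δ, g y = 0) :
    MemLpm p m (yPow a fun z : Pt N => f z.1 * g z.2) := by
  have hp0 : 0 < p := by linarith
  set q := a * p + m with hq
  have hcont : Continuous fun z : Pt N => f z.1 * g z.2 :=
    (hf.comp continuous_fst).mul (hg.comp continuous_snd)
  refine ⟨aestronglyMeasurable_yPow hcont.aestronglyMeasurable m a, ?_⟩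
  have hne : normLpm p m (yPow a fun z : Pt N => f z.1 * g z.2) ^ p ≠ ⊤ := by
    rw [normLpm_yPow_rpow hp0]
    have hm1 : Measurable fun x => ‖f x‖ₑ ^ p := hf.enorm.measurable.pow_const p
    have hm2 : Measurable ((Ioi (0 : ℝ)).indicator fun y => ENNReal.ofReal (y ^ q) * ‖g y‖ₑ ^ p) :=
      ((measurable_id.pow_const q).ennreal_ofReal.mul (hg.enorm.measurable.pow_const p)).indicator
        measurableSet_Ioi
    have e : ∫⁻ z in halfSpace N, ENNReal.ofReal (z.2 ^ q) * ‖f z.1 * g z.2‖ₑ ^ p =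
        (∫⁻ x, ‖f x‖ₑ ^ p) * ∫⁻ y in Ioi (0 : ℝ), ENNReal.ofReal (y ^ q) * ‖g y‖ₑ ^ p := by
      have := lintegral_prod_mul (μ := (volume : Measure (EuclideanSpace ℝ (Fin N))))
        (ν := (volume : Measure ℝ)) hm1.aemeasurable hm2.aemeasurable
      rw [lintegral_indicator measurableSet_Ioi] at this
      rw [← this, ← lintegral_indicator isOpen_halfSpace.measurableSet]
      refine lintegral_congr fun z => ?_
      by_cases hz : 0 < z.2
      · have h1 : z ∈ halfSpace N := hz
        have h2 : z.2 ∈ Ioi (0 : ℝ) := hz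
        rw [indicator_of_mem h1, indicator_of_mem h2, enorm_mul,
          ENNReal.mul_rpow_of_nonneg _ _ hp0.le]
        ring
      · have h1 : z ∉ halfSpace N := hz
        have h2 : z.2 ∉ Ioi (0 : ℝ) := hz
        rw [indicator_of_notMem h1, indicator_of_notMem h2, mul_zero]
    rw [e]
    refine ENNReal.mul_ne_top ?_ ?_
    · rw [← eLpNorm_ofReal_rpow hp0]
      exact ENNReal.rpow_ne_top_of_nonneg hp0.le (hf.memLp_of_hasCompactSupport hfc).2.ne
    · obtain ⟨C, hC⟩ := isCompact_Icc.exists_bound_of_continuousOn (s := Icc 0 R) hg.continuousOn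
      -- it suffices to integrate the weight over an interval carrying `g`
      have key : ∀ S : Set ℝ, MeasurableSet S → (∀ y, 0 < y → y ∉ S → g y = 0) → S ⊆ Icc 0 R →
          IntegrableOn (fun y : ℝ => y ^ q) S →
          ∫⁻ y in Ioi (0 : ℝ), ENNReal.ofReal (y ^ q) * ‖g y‖ₑ ^ p ≠ ⊤ := by
        intro S hS hS0 hSR hi
        have hle : ∫⁻ y in Ioi (0 : ℝ), ENNReal.ofReal (y ^ q) * ‖g y‖ₑ ^ p ≤
            ∫⁻ y in S, ENNReal.ofReal C ^ p * ENNReal.ofReal (y ^ q) := by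
          rw [← lintegral_indicator measurableSet_Ioi, ← lintegral_indicator hS]
          refine lintegral_mono fun y => ?_
          by_cases hy : y ∈ S
          · rw [indicator_of_mem hy]
            refine (indicator_le_self _ _ _).trans ?_
            rw [mul_comm]
            gcongr
            rw [← ofReal_norm]
            exact ENNReal.ofReal_le_ofReal (hC y (hSR hy))
          · by_cases hy0 : y ∈ Ioi (0 : ℝ)
            · rw [indicator_of_mem hy0, hS0 y hy0 hy]
              simp [hp0]
            · rw [indicator_of_notMem hy0]
              exact zero_le
        refine ne_top_of_le_ne_top ?_ hle
        have hCt : ENNReal.ofReal C ^ p ≠ ⊤ :=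
          ENNReal.rpow_ne_top_of_nonneg hp0.le ENNReal.ofReal_ne_top
        rw [lintegral_const_mul' _ _ hCt]
        refine ENNReal.mul_ne_top hCt ?_
        exact ((lintegral_mono fun y => by
          rw [← ofReal_norm]; exact ENNReal.ofReal_le_ofReal (Real.le_norm_self _)).trans_lt hi.2).ne
      rcases h with h | ⟨δ, hδ, hg0⟩
      · refine key (Ioo 0 R) measurableSet_Ioo (fun y hy hn => hgR y ?_) Ioo_subset_Icc_self
          ((intervalIntegral.integrableOn_Ioo_rpow_iff hR).2 h)
        by_contra hlt
        exact hn ⟨hy, not_le.1 hlt⟩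
      · refine key (Icc δ R) measurableSet_Icc (fun y _ hn => ?_) (Icc_subset_Icc_left hδ.le) ?_
        · rcases lt_or_ge y δ with h1 | h1
          · exact hg0 y h1
          · exact hgR y (le_of_lt (by by_contra h2; exact hn ⟨h1, not_lt.1 h2⟩))
        · refine ContinuousOn.integrableOn_compact isCompact_Icc ?_
          exact continuousOn_id.rpow_const fun y hy => Or.inl (hδ.trans_le hy.1).ne'
  exact lt_top_iff_ne_top.2 fun ht => hne (by
    rw [normLpm, ht]; exact ENNReal.top_rpow_of_pos hp0)

lemma memLpm_yPow_tensorSum (hp : 1 < p) {n : ℕ} {f : Fin n → EuclideanSpace ℝ (Fin N) → 𝕜}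
    {g : Fin n → ℝ → 𝕜} (hf : ∀ i, ContDiff ℝ ∞ (f i) ∧ HasCompactSupport (f i))
    (hg : ∀ i, ContDiff ℝ ∞ (g i)) (hgR : ∀ i, ∃ R : ℝ, 0 < R ∧ ∀ y, R ≤ y → g i y = 0)
    (h : -1 < a * p + m ∨ ∀ i, ∃ δ : ℝ, 0 < δ ∧ ∀ y < δ, g i y = 0) :
    MemLpm p m (yPow a (tensorSum f g)) := by
  have e : yPow a (tensorSum f g) =
      fun z => ∑ i, yPow a (fun z : Pt N => f i z.1 * g i z.2) z := by
    funext z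
    simp only [yPow, tensorSum, Finset.smul_sum]
  rw [e]
  refine memLp_finsetSum _ fun i _ => ?_
  obtain ⟨R, hR, hR'⟩ := hgR i
  exact memLpm_yPow_mul hp (hf i).1.continuous (hf i).2 (hg i).continuous hR hR'
    (h.imp_right fun h => h i)

lemma memLpLoc_of_continuous {w v : Pt N → 𝕜} (hw : Continuous w)
    (h : v =ᵐ[volume.restrict (halfSpace N)] w) : MemLpLoc p v := by
  intro K hK hs
  have hae : v =ᵐ[volume.restrict K] w := ae_restrict_of_ae_restrict_of_subset hs h
  refine (memLp_congr_ae hae).2 ?_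
  obtain ⟨C, hC⟩ := hK.exists_bound_of_continuousOn hw.continuousOn
  have : IsFiniteMeasure (volume.restrict K) := ⟨by simpa using hK.measure_lt_top⟩
  exact MemLp.of_bound hw.aestronglyMeasurable C
    (ae_restrict_of_forall_mem hK.measurableSet hC)

lemma neg_one_lt_of_max_lt (hp : 1 < p) {α : ℝ} (hm : max (-α) 0 < (m + 1) / p) :
    -1 < 0 * p + m ∧ -1 < α * p + m ∧ -1 < α / 2 * p + m := by
  have hp0 : 0 < p := by linarith
  have h1 := (le_max_left (-α) 0).trans_lt hm
  have h2 := (le_max_right (-α) 0).trans_lt hm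
  rw [lt_div_iff₀ hp0] at h1 h2
  refine ⟨?_, ?_, ?_⟩ <;> linarith

/-- The tensor products belong to the weighted space. -/
lemma memWN_of_mem_tensorCcD {α₁ α₂ : ℝ} (hp : 1 < p) (hm : max (-α₁) 0 < (m + 1) / p)
    {w : Pt N → 𝕜} (hw : w ∈ tensorCcD N 𝕜) : MemWN p α₁ α₂ m w := by
  obtain ⟨n, f, g, hf, hg, rfl⟩ := hw
  obtain ⟨h0, h1, h2⟩ := neg_one_lt_of_max_lt hp hm
  set G : Fin n → ℝ → 𝕜 := fun i y => g i (max y 0) with hG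
  have hGs : ∀ i, ContDiff ℝ ∞ (G i) := fun i => (hg i).extend.1
  have hGR : ∀ i, ∃ R : ℝ, 0 < R ∧ ∀ y, R ≤ y → G i y = 0 := fun i => (hg i).extend.2.1
  have hG' : ∀ i, ContDiff ℝ ∞ (deriv (G i)) := fun i => ((contDiff_infty_iff_deriv).1 (hGs i)).2
  have hG'' : ∀ i, ContDiff ℝ ∞ (deriv (deriv (G i))) := fun i =>
    ((contDiff_infty_iff_deriv).1 (hG' i)).2
  have hloc : ∀ {h : ℝ → 𝕜} {s : Set ℝ} {c : 𝕜}, IsOpen s → (∀ y ∈ s, h y = c) →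
      ∀ y ∈ s, deriv h y = 0 := by
    intro h s c hs hc y hy
    have : h =ᶠ[nhds y] fun _ => c := by
      filter_upwards [hs.mem_nhds hy] with t ht using hc t ht
    rw [this.deriv_eq, deriv_const]
  have hR : ∀ {h : ℝ → 𝕜}, (∃ R : ℝ, 0 < R ∧ ∀ y, R ≤ y → h y = 0) →
      ∃ R : ℝ, 0 < R ∧ ∀ y, R ≤ y → deriv h y = 0 := by
    rintro h ⟨R, hR, hz⟩
    refine ⟨R + 1, by linarith, fun y hy => hloc (s := Ioi R) (c := 0) isOpen_Ioi
      (fun t ht => hz t (le_of_lt ht)) y ?_⟩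
    exact lt_of_lt_of_le (by linarith) hy
  have hδ : ∀ i, ∃ δ : ℝ, 0 < δ ∧ ∀ y < δ, deriv (G i) y = 0 := fun i => by
    obtain ⟨δ, hδ, hc⟩ := (hg i).extend.2.2
    exact ⟨δ, hδ, fun y hy => hloc (s := Iio δ) isOpen_Iio (fun t ht => hc t ht) y hy⟩
  have hδ' : ∀ i, ∃ δ : ℝ, 0 < δ ∧ ∀ y < δ, deriv (deriv (G i)) y = 0 := fun i => by
    obtain ⟨δ, hδ, hc⟩ := hδ i
    exact ⟨δ, hδ, fun y hy => hloc (s := Iio δ) isOpen_Iio (fun t ht => hc t ht) y hy⟩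
  set v := tensorSum f G with hv
  have hvs : ContDiff ℝ ∞ v := contDiff_tensorSum (fun i => (hf i).1) hGs
  set w : Pt N → 𝕜 := fun z => ∑ i, f i z.1 * g i z.2 with hw
  have hwv : w =ᵐ[volume.restrict (halfSpace N)] v := by
    refine ae_restrict_of_forall_mem isOpen_halfSpace.measurableSet fun z hz => ?_
    have hz0 : 0 < z.2 := hz
    simp [hw, hv, tensorSum, hG, max_eq_left hz0.le]
  have d1 : ∀ k, IsWeakDeriv k w (pderiv k v) := fun k =>
    (isWeakDeriv_pderiv hvs k).congr hwv.symm .rfl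
  have e1 : ∀ k, weakDeriv k w =ᵐ[volume.restrict (halfSpace N)] pderivs [k] v := fun k =>
    (d1 k).weakDeriv_ae_eq
  have d2 : ∀ k l, IsWeakDeriv l (weakDeriv k w) (pderivs [l, k] v) := fun k l =>
    (isWeakDeriv_pderiv (contDiff_pderiv hvs k) l).congr (e1 k).symm .rfl
  have e2 : ∀ k l, weakDeriv l (weakDeriv k w) =ᵐ[volume.restrict (halfSpace N)]
      pderivs [l, k] v := fun k l => (d2 k l).weakDeriv_ae_eq
  have hcg : ∀ {b : ℝ} {F F' : Pt N → 𝕜}, F =ᵐ[volume.restrict (halfSpace N)] F' →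
      MemLpm p m (yPow b F') → MemLpm p m (yPow b F) := by
    intro b F F' hF h
    refine (memLp_congr_ae ?_).1 h
    filter_upwards [(weightedMeasure_absolutelyContinuous m).ae_le hF] with z hz
    simp [yPow, hz]
  have hx : ∀ (L : List (Fin N)) {b : ℝ}, -1 < b * p + m →
      MemLpm p m (yPow b (pderivs (L.map Sum.inl) v)) := by
    intro L b hb
    obtain ⟨f', hf', h⟩ := exists_pderivs_inl_tensorSum hf L
    rw [hv, h G hGs]
    exact memLpm_yPow_tensorSum hp hf' hGs hGR (Or.inl hb)
  have hy1 : ∀ b : ℝ, MemLpm p m (yPow b (pderivs [Sum.inr ()] v)) := by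
    intro b
    rw [pderivs, pderivs, hv, pderiv_inr_tensorSum (fun i => (hf i).1) hGs]
    exact memLpm_yPow_tensorSum hp hf hG' (fun i => hR (hGR i)) (Or.inr hδ)
  have hy2 : ∀ b : ℝ, MemLpm p m (yPow b (pderivs [Sum.inr (), Sum.inr ()] v)) := by
    intro b
    rw [pderivs, pderivs, pderivs, hv, pderiv_inr_tensorSum (fun i => (hf i).1) hGs,
      pderiv_inr_tensorSum (fun i => (hf i).1) hG']
    exact memLpm_yPow_tensorSum hp hf hG'' (fun i => hR (hR (hGR i))) (Or.inr hδ')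
  refine ⟨⟨⟨memLpLoc_of_continuous hvs.continuous hwv, fun k => ⟨⟨_, d1 k⟩,
    memLpLoc_of_continuous (contDiff_pderivs hvs _).continuous (e1 k), fun l => ⟨⟨_, d2 k l⟩,
    memLpLoc_of_continuous (contDiff_pderivs hvs _).continuous (e2 k l)⟩⟩⟩, ?_,
    fun i j => hcg (e2 _ _) (hx [i, j] h1), fun i => hcg (e1 _) (hx [i] h2),
    hcg (e2 _ _) (hy2 _), hcg (e1 _) (hy1 _)⟩, hcg (e1 _) (hy1 _)⟩
  have := hcg hwv (hx [] h0)
  have e : yPow 0 w = w := by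
    funext z
    simp [yPow]
  rwa [e] at this

end Membership

/-! ### Density -/

section Density
open Filter Topology
variable {N : ℕ} {𝕜 : Type*} [RCLike 𝕜] {p m : ℝ}

/-- The iterated weak derivative along a list of coordinate directions; the head of the list is
applied last. -/
def weakDerivs : List (Fin N ⊕ Unit) → (Pt N → 𝕜) → Pt N → 𝕜
  | [], u => u
  | k :: L, u => weakDeriv k (weakDerivs L u)

lemma exists_bound_rpow_Icc {s : ℝ} (hs : 0 < s) (t q : ℝ) :
    ∃ M : ℝ, ∀ y ∈ Icc s t, y ^ q ≤ M := by
  obtain ⟨M, hM⟩ := isCompact_Icc.exists_bound_of_continuousOn (s := Icc s t)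
    (f := fun y : ℝ => y ^ q) (continuousOn_id.rpow_const fun y hy => Or.inl (hs.trans_le hy.1).ne')
  exact ⟨M, fun y hy => (Real.le_norm_self _).trans (hM y hy)⟩

/-- On a strip away from the boundary the weighted norm is bounded by the unweighted one. -/
lemma exists_normLpm_strip_le (hp : 0 < p) (m a : ℝ) {s : ℝ} (hs : 0 < s) (t : ℝ) :
    ∃ K : ℝ≥0∞, K ≠ ⊤ ∧ ∀ F : Pt N → 𝕜, normLpm p m (yPow a ((strip N s t).indicator F)) ≤
      K * eLpNorm F (ENNReal.ofReal p) (volume.restrict (strip N s t)) := by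
  obtain ⟨M, hM⟩ := exists_bound_rpow_Icc hs t (a * p + m)
  refine ⟨ENNReal.ofReal M ^ (1 / p), ENNReal.rpow_ne_top_of_nonneg (by positivity)
    ENNReal.ofReal_ne_top, fun F => ?_⟩
  rw [← ENNReal.rpow_le_rpow_iff hp, ENNReal.mul_rpow_of_nonneg _ _ hp.le, ← ENNReal.rpow_mul,
    one_div_mul_cancel hp.ne', ENNReal.rpow_one, eLpNorm_ofReal_rpow hp, normLpm_yPow_rpow hp,
    ← lintegral_const_mul' _ _ ENNReal.ofReal_ne_top]
  rw [← lintegral_indicator isOpen_halfSpace.measurableSet,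
    ← lintegral_indicator (measurableSet_strip s t)]
  refine lintegral_mono fun z => ?_
  by_cases hz : z ∈ strip N s t
  · rw [indicator_of_mem hz, indicator_of_mem (strip_subset_halfSpace hs hz), indicator_of_mem hz]
    gcongr
    exact hM _ hz
  · rw [indicator_of_notMem hz, Set.indicator, indicator_of_notMem hz]
    simp [hp]

/-- A function of finite weighted norm is in `L^p` on strips away from the boundary. -/
lemma MemLpm.memLp_strip (hp : 0 < p) {a : ℝ} {F : Pt N → 𝕜}
    (hF : AEStronglyMeasurable F (volume.restrict (halfSpace N))) (h : MemLpm p m (yPow a F))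
    {s : ℝ} (hs : 0 < s) (t : ℝ) :
    MemLp F (ENNReal.ofReal p) (volume.restrict (strip N s t)) := by
  have hsub := strip_subset_halfSpace (N := N) (b := t) hs
  refine ⟨hF.mono_measure (Measure.restrict_mono hsub le_rfl), ?_⟩
  obtain ⟨M, hM⟩ := exists_bound_rpow_Icc hs t (-(a * p + m))
  have hfin : normLpm p m (yPow a F) ^ p ≠ ⊤ := ENNReal.rpow_ne_top_of_nonneg hp.le h.2.ne
  have hle : eLpNorm F (ENNReal.ofReal p) (volume.restrict (strip N s t)) ^ p ≤
      ENNReal.ofReal M * normLpm p m (yPow a F) ^ p := by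
    rw [eLpNorm_ofReal_rpow hp, normLpm_yPow_rpow hp, ← lintegral_const_mul' _ _ ENNReal.ofReal_ne_top]
    refine le_trans ?_ (lintegral_mono_set hsub)
    refine setLIntegral_mono' (measurableSet_strip s t) fun z hz => ?_
    have hz0 : 0 < z.2 := hsub hz
    rw [← mul_assoc, ← ENNReal.ofReal_mul' (by positivity)]
    refine le_mul_of_one_le_left' (ENNReal.one_le_ofReal.2 ?_)
    calc (1 : ℝ) = z.2 ^ (-(a * p + m)) * z.2 ^ (a * p + m) := by
          rw [← Real.rpow_add hz0]; simp
      _ ≤ M * z.2 ^ (a * p + m) := by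
          gcongr
          exact hM _ hz
  refine lt_top_iff_ne_top.2 fun ht => ?_
  rw [ht, ENNReal.top_rpow_of_pos hp] at hle
  exact (ENNReal.mul_ne_top ENNReal.ofReal_ne_top hfin) (top_le_iff.1 hle)

lemma tendsto_normLpm_tailSet (hp : 0 < p) {a : ℝ} {F : Pt N → 𝕜} (h : MemLpm p m (yPow a F)) :
    Tendsto (fun n : ℕ => normLpm p m (yPow a ((tailSet N n).indicator F))) atTop (𝓝 0) := by
  have e : ∀ S : Set (Pt N), yPow a (S.indicator F) = S.indicator (yPow a F) := by
    intro S
    funext z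
    by_cases hz : z ∈ S <;> simp [yPow, hz]
  simp only [e]
  refine tendsto_eLpNorm_indicator_zero hp h (fun n => measurableSet_tailSet _)
    (ae_weightedMeasure_of_halfSpace fun z hz => ?_)
  have hz0 : 0 < z.2 := hz
  have h1 : ∀ᶠ n : ℕ in atTop, z.2 < n := tendsto_natCast_atTop_atTop.eventually_gt_atTop _
  have h2 : ∀ᶠ n : ℕ in atTop, 2 / (n : ℝ) < z.2 :=
    (tendsto_const_div_atTop_nhds_zero_nat 2).eventually_lt_const hz0
  filter_upwards [h1, h2] with n h1 h2
  simp only [tailSet, mem_ofPred_eq, not_or, not_le]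
  exact ⟨h2, h1⟩

/-- Finitely many weighted weak derivatives of a function are approximated simultaneously by those
of tensor products. -/
lemma exists_approxError_le (hp : 1 < p) {u : Pt N → 𝕜}
    (hu : AEStronglyMeasurable u (volume.restrict (halfSpace N))) (hu0 : MemLpm p m u)
    (Λ : Finset (ℝ × List (Fin N ⊕ Unit)))
    (hw : ∀ c ∈ Λ, IsWeakDerivs c.2 u (weakDerivs c.2 u))
    (hs : ∀ c ∈ Λ, AEStronglyMeasurable (weakDerivs c.2 u) (volume.restrict (halfSpace N)))
    (hm : ∀ c ∈ Λ, MemLpm p m (yPow c.1 (weakDerivs c.2 u))) {η : ℝ≥0∞} (hη : 0 < η) :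
    ∃ (r : ℝ) (n : ℕ) (f : Fin n → EuclideanSpace ℝ (Fin N) → 𝕜) (g : Fin n → ℝ → 𝕜),
      1 ≤ r ∧ (∀ i, ContDiff ℝ ∞ (f i) ∧ HasCompactSupport (f i)) ∧ (∀ i, ContDiff ℝ ∞ (g i)) ∧
      ∀ c ∈ Λ, approxError p m c.1 r (weakDerivs c.2 u) (pderivs c.2 (tensorSum f g)) ≤ η := by
  have hp0 : 0 < p := by linarith
  have hη2 : 0 < η / 2 := ENNReal.half_pos hη.ne'
  have h1 : ∀ᶠ n : ℕ in atTop, ∀ c ∈ Λ,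
      normLpm p m (yPow c.1 ((tailSet N n).indicator (weakDerivs c.2 u))) ≤ η / 2 :=
    (Filter.eventually_all_finset Λ).2 fun c hc =>
      (tendsto_normLpm_tailSet hp0 (hm c hc)).eventually_le_const hη2
  obtain ⟨k, hk, hk1⟩ := (h1.and (eventually_ge_atTop 1)).exists
  set r : ℝ := (k : ℝ) with hr
  have hr1 : 1 ≤ r := by rw [hr]; exact_mod_cast hk1
  have hr0 : 0 < r := by linarith
  choose K hKt hK using fun a : ℝ =>
    exists_normLpm_strip_le (N := N) (𝕜 := 𝕜) hp0 m a (s := 1 / r) (by positivity) (2 * r)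
  obtain ⟨δ, hδ, hδη⟩ := ENNReal.exists_nnreal_pos_mul_lt
    (ENNReal.sum_ne_top.2 fun c (_ : c ∈ Λ) => hKt c.1) hη2.ne'
  have h0 : 0 < 1 / (2 * r) := by positivity
  have hu0' : MemLpm p m (yPow 0 u) := by
    have e : yPow 0 u = u := by
      funext z
      simp [yPow]
    rwa [e]
  obtain ⟨n, f, g, hf, hg, hfg⟩ := exists_tensorSum_eLpNorm_le hp (u := u)
    (Λ := Λ.image Prod.snd) (G := fun L => weakDerivs L u) (a := 1 / r) (b := 2 * r)
    (a' := 1 / (2 * r)) (b' := 3 * r) h0 (one_div_lt_one_div_of_lt hr0 (by linarith)) (by linarith)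
    (fun L hL => by
      obtain ⟨c, hc, rfl⟩ := Finset.mem_image.1 hL
      exact hw c hc) (hu0'.memLp_strip hp0 hu h0 _)
    (fun L hL => by
      obtain ⟨c, hc, rfl⟩ := Finset.mem_image.1 hL
      exact (hm c hc).memLp_strip hp0 (hs c hc) h0 _)
    (ε := δ) (by exact_mod_cast hδ)
  refine ⟨r, n, f, g, hr1, hf, hg, fun c hc => ?_⟩
  rw [approxError, ← ENNReal.add_halves η]
  refine add_le_add (hk c hc) ((hK c.1 _).trans (le_trans ?_ hδη.le))
  rw [mul_comm]
  gcongr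
  · exact hfg c.2 (Finset.mem_image_of_mem _ hc)
  · exact Finset.single_le_sum (f := fun c : ℝ × List (Fin N ⊕ Unit) => K c.1)
      (fun _ _ => zero_le) hc

/-- The norm of the difference of `u` and a smooth function, in terms of classical derivatives of
the latter. -/
lemma normWN_sub_le {α₁ α₂ : ℝ} {u W : Pt N → 𝕜} (hu : MemWN p α₁ α₂ m u) (hW : ContDiff ℝ ∞ W)
    {B : ℝ≥0∞} (h0 : normLpm p m (yPow 0 (weakDerivs [] u - pderivs [] W)) ≤ B)
    (hxx : ∀ i j : Fin N, normLpm p m (yPow α₁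
      (weakDerivs [Sum.inl i, Sum.inl j] u - pderivs [Sum.inl i, Sum.inl j] W)) ≤ B)
    (hx : ∀ i : Fin N, normLpm p m (yPow (α₁ / 2)
      (weakDerivs [Sum.inl i] u - pderivs [Sum.inl i] W)) ≤ B)
    (hyy : normLpm p m (yPow α₂ (weakDerivs [Sum.inr (), Sum.inr ()] u -
      pderivs [Sum.inr (), Sum.inr ()] W)) ≤ B)
    (hy : normLpm p m (yPow (α₂ / 2) (weakDerivs [Sum.inr ()] u - pderivs [Sum.inr ()] W)) ≤ B)
    (hy' : normLpm p m (yPow (α₂ - 1) (weakDerivs [Sum.inr ()] u - pderivs [Sum.inr ()] W)) ≤ B) :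
    normWN p α₁ α₂ m (u - W) ≤ (4 + N * N + N) * B := by
  have hloc := hu.1.1.2
  have e0 : yPow 0 (u - W) = u - W := by
    funext z
    simp [yPow]
  have e1 : ∀ k (a : ℝ), normLpm p m (yPow a (weakDeriv k (u - W))) =
      normLpm p m (yPow a (weakDerivs [k] u - pderivs [k] W)) := fun k a =>
    normLpm_congr (weakDeriv_sub_ae_eq hW .rfl (hloc k).1)
  have e2 : ∀ k l (a : ℝ), normLpm p m (yPow a (weakDeriv l (weakDeriv k (u - W)))) =
      normLpm p m (yPow a (weakDerivs [l, k] u - pderivs [l, k] W)) := fun k l a =>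
    normLpm_congr (weakDeriv_weakDeriv_sub_ae_eq hW .rfl (hloc k).1 ((hloc k).2.2 l).1)
  rw [weakDerivs, pderivs, e0] at h0
  simp only [normWN, normW, Dxx, Dx, Dyy, Dy, e1, e2]
  calc _ ≤ B + (∑ _i : Fin N, ∑ _j : Fin N, B) + (∑ _i : Fin N, B) + B + B + B := by
        gcongr with i _ j _ i _
        · exact hxx i j
        · exact hx i
    _ = _ := by
        simp only [Finset.sum_const, Finset.card_univ, Fintype.card_fin, nsmul_eq_mul]
        ring

/-- Density of the tensor products: `u` is approximated on a strip `1/r ≤ y ≤ 2r` by smooth tensor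
products, which are then regularized at the boundary. -/
lemma exists_mem_tensorCcD_normWN_sub_lt {α₁ α₂ : ℝ} (hp : 1 < p) (hα₂ : α₂ < 2)
    (hm : max (-α₁) 0 < (m + 1) / p) {u : Pt N → 𝕜} (hu : MemWN p α₁ α₂ m u) {ε : ℝ≥0∞}
    (hε : 0 < ε) : ∃ w ∈ tensorCcD N 𝕜, normWN p α₁ α₂ m (u - w) < ε := by
  obtain ⟨ha0, ha1, ha2⟩ := neg_one_lt_of_max_lt hp hm
  obtain ⟨K₀, hK₀, H₀⟩ := exists_normLpm_sub_regularized_le (N := N) (𝕜 := 𝕜) hp ha0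
  obtain ⟨K₁, hK₁, H₁⟩ := exists_normLpm_sub_regularized_le (N := N) (𝕜 := 𝕜) hp ha1
  obtain ⟨K₂, hK₂, H₂⟩ := exists_normLpm_sub_regularized_le (N := N) (𝕜 := 𝕜) hp ha2
  obtain ⟨K₃, hK₃, H₃⟩ := exists_normLpm_sub_regularized_deriv_le (N := N) (𝕜 := 𝕜) (m := m) hp
    (a := α₂ / 2) (by linarith)
  obtain ⟨K₄, hK₄, H₄⟩ := exists_normLpm_sub_regularized_deriv_le (N := N) (𝕜 := 𝕜) (m := m) hp
    (a := α₂ - 1) (by linarith)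
  obtain ⟨K₅, hK₅, H₅⟩ := exists_normLpm_sub_regularized_deriv_deriv_le (N := N) (𝕜 := 𝕜) (m := m)
    hp (a := α₂) hα₂.le
  set K := 3 * (K₀ + K₁ + K₂ + K₃ + K₄ + K₅) with hK
  obtain ⟨η, hη, hηε⟩ := ENNReal.exists_nnreal_pos_mul_lt
    (a := (4 + N * N + N) * K) (b := ε) (by rw [hK]; finiteness) hε.ne'
  have hη0 : (0 : ℝ≥0∞) < η := by exact_mod_cast hη
  obtain ⟨⟨⟨-, hloc⟩, hu0, huxx, hux, huyy, huy⟩, huy'⟩ := id hu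
  have d1 : ∀ k, IsWeakDeriv k u (weakDeriv k u) := fun k => (hloc k).1.isWeakDeriv
  have d2 : ∀ k l, IsWeakDeriv l (weakDeriv k u) (weakDeriv l (weakDeriv k u)) := fun k l =>
    ((hloc k).2.2 l).1.isWeakDeriv
  have s0 : AEStronglyMeasurable u (volume.restrict (halfSpace N)) :=
    (d1 (Sum.inr ())).1.aestronglyMeasurable
  have s1 : ∀ k, AEStronglyMeasurable (weakDerivs [k] u) (volume.restrict (halfSpace N)) := fun k =>
    (d1 k).2.1.aestronglyMeasurable
  have s2 : ∀ k l, AEStronglyMeasurable (weakDerivs [l, k] u) (volume.restrict (halfSpace N)) :=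
    fun k l => (d2 k l).2.1.aestronglyMeasurable
  -- the pairs of exponents and derivatives occurring in the norm
  classical
  let y : Fin N ⊕ Unit := Sum.inr ()
  let Λ : Finset (ℝ × List (Fin N ⊕ Unit)) :=
    {(0, []), (α₂, [y, y]), (α₂ / 2, [y]), (α₂ - 1, [y])} ∪
      (Finset.univ.image fun i : Fin N => (α₁ / 2, [Sum.inl i])) ∪
      Finset.univ.image fun ij : Fin N × Fin N => (α₁, [Sum.inl ij.1, Sum.inl ij.2])
  have hΛ : ∀ P : ℝ × List (Fin N ⊕ Unit) → Prop, P (0, []) → P (α₂, [y, y]) → P (α₂ / 2, [y]) →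
      P (α₂ - 1, [y]) → (∀ i, P (α₁ / 2, [Sum.inl i])) →
      (∀ i j, P (α₁, [Sum.inl i, Sum.inl j])) → ∀ c ∈ Λ, P c := by
    intro P p1 p2 p3 p4 p5 p6 c hc
    simp only [Λ, Finset.mem_union, Finset.mem_insert, Finset.mem_singleton, Finset.mem_image,
      Finset.mem_univ, true_and] at hc
    rcases hc with ((rfl | rfl | rfl | rfl) | ⟨i, rfl⟩) | ⟨ij, rfl⟩
    exacts [p1, p2, p3, p4, p5 i, p6 ij.1 ij.2]
  have e0 : yPow 0 u = u := by
    funext z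
    simp [yPow]
  obtain ⟨r, n, f, g, hr, hf, hg, hE⟩ := exists_approxError_le hp s0 hu0 Λ
    (hΛ _ (isWeakDerivs_nil u) ((d1 y).isWeakDerivs_cons (d2 y y)) (d1 y).isWeakDerivs
      (d1 y).isWeakDerivs (fun i => (d1 _).isWeakDerivs)
      fun i j => (d1 (Sum.inl j)).isWeakDerivs_cons (d2 (Sum.inl j) (Sum.inl i)))
    (hΛ _ s0 (s2 _ _) (s1 _) (s1 _) (fun i => s1 _) fun i j => s2 _ _)
    (hΛ _ (e0.symm ▸ hu0) huyy huy huy' hux huxx) hη0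
  have hr0 : 0 < r := by linarith
  have hE0 : approxError p m 0 r u (tensorSum f g) ≤ η := hE (0, []) (by simp [Λ])
  have hEyy : approxError p m α₂ r (weakDerivs [y, y] u) (pderivs [y, y] (tensorSum f g)) ≤ η :=
    hE (α₂, [y, y]) (by simp [Λ])
  have hEy : approxError p m (α₂ / 2) r (weakDerivs [y] u) (pderivs [y] (tensorSum f g)) ≤ η :=
    hE (α₂ / 2, [y]) (by simp [Λ])
  have hEy' : approxError p m (α₂ - 1) r (weakDerivs [y] u) (pderivs [y] (tensorSum f g)) ≤ η :=
    hE (α₂ - 1, [y]) (by simp [Λ])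
  have hEx : ∀ i, approxError p m (α₁ / 2) r (weakDerivs [Sum.inl i] u)
      (pderivs [Sum.inl i] (tensorSum f g)) ≤ η := fun i =>
    hE (α₁ / 2, [Sum.inl i]) (by simp [Λ])
  have hExx : ∀ i j, approxError p m α₁ r (weakDerivs [Sum.inl i, Sum.inl j] u)
      (pderivs [Sum.inl i, Sum.inl j] (tensorSum f g)) ≤ η := fun i j =>
    hE (α₁, [Sum.inl i, Sum.inl j]) (by simp [Λ])
  -- the regularized tensor sum
  have hf1 : ∀ i, ContDiff ℝ ∞ (f i) := fun i => (hf i).1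
  have hg' : ∀ i, ContDiff ℝ ∞ (deriv (g i)) := fun i => ((contDiff_infty_iff_deriv).1 (hg i)).2
  have hR : ∀ i, ContDiff ℝ ∞ (regularize r (g i)) := fun i => contDiff_regularize r (hg i)
  have hR' : ∀ i, ContDiff ℝ ∞ (deriv (regularize r (g i))) := fun i =>
    ((contDiff_infty_iff_deriv).1 (hR i)).2
  have hgc : ∀ i, Continuous (g i) := fun i => (hg i).continuous
  set V := tensorSum f g with hV
  set W := tensorSum f (fun i => regularize r (g i)) with hW
  have hVs : ContDiff ℝ ∞ V := contDiff_tensorSum hf1 hg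
  have hWs : ContDiff ℝ ∞ W := contDiff_tensorSum hf1 hR
  have cV : ∀ L, Continuous (pderivs L V) := fun L => (contDiff_pderivs hVs L).continuous
  have cW : ∀ L, Continuous (pderivs L W) := fun L => (contDiff_pderivs hWs L).continuous
  have hmean : Continuous (meanY r V) := by
    have e : meanY r V = fun z => ∑ j, f j z.1 * mean r (g j) := funext (meanY_tensorSum hgc r)
    rw [e]
    exact continuous_finsetSum _ fun j _ =>
      ((hf1 j).continuous.comp continuous_fst).mul continuous_const
  have hx : ∀ (L : List (Fin N)) (z : Pt N), pderivs (L.map Sum.inl) W z =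
      (cutoff (z.2 / r) - cutoff (r * z.2)) • pderivs (L.map Sum.inl) V z +
        cutoff (r * z.2) • meanY r (pderivs (L.map Sum.inl) V) z := by
    intro L z
    obtain ⟨f', -, h⟩ := exists_pderivs_inl_tensorSum hf L
    rw [hV, hW, h _ hg, h _ hR]
    exact tensorSum_regularize hgc r z
  have hVy : pderivs [y] V = tensorSum f fun i => deriv (g i) := pderiv_inr_tensorSum hf1 hg
  have hVyy : pderivs [y, y] V = tensorSum f fun i => deriv (deriv (g i)) := by
    rw [pderivs, hVy]
    exact pderiv_inr_tensorSum hf1 hg'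
  have hWy : pderivs [y] W = tensorSum f fun i => deriv (regularize r (g i)) :=
    pderiv_inr_tensorSum hf1 hR
  have hWyy : pderivs [y, y] W = tensorSum f fun i => deriv (deriv (regularize r (g i))) := by
    rw [pderivs, hWy]
    exact pderiv_inr_tensorSum hf1 hR'
  have hP : ∀ z ∈ strip N (1 / r) (2 / r),
      ‖V z - meanY r V z‖ₑ ≤ ∫⁻ s in Icc (1 / r) (2 / r), ‖pderivs [y] V (z.1, s)‖ₑ := by
    intro z hz
    have hsm : ContDiff ℝ ∞ fun s : ℝ => V (z.1, s) := hVs.comp (contDiff_prodMk_right z.1)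
    have hd : ∀ s, deriv (fun s : ℝ => V (z.1, s)) s = pderivs [y] V (z.1, s) := by
      intro s
      have h1 := (hVs.differentiable (by simp) (z.1, s)).hasFDerivAt
      have h2 : HasDerivAt (fun s : ℝ => ((z.1, s) : Pt N)) (0, 1) s :=
        (hasDerivAt_const s z.1).prodMk (hasDerivAt_id s)
      exact (h1.comp_hasDerivAt s h2).deriv
    have := enorm_sub_mean_le hr0 hsm hz
    simp only [hd] at this
    exact this
  have hWy' := tensorSum_deriv_regularize (f := f) hg r
  have hWyy' := tensorSum_deriv_deriv_regularize (f := f) hg r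
  simp only [← hVy, ← hVyy, ← hWy, ← hWyy] at hWy' hWyy'
  have hη1 : (η : ℝ≥0∞) ≤ 3 * η := le_mul_of_one_le_left' (by norm_num)
  have hη2 : (η : ℝ≥0∞) + η ≤ 3 * η := by
    rw [← two_mul]; gcongr; norm_num
  have hη3 : (η : ℝ≥0∞) + η + η ≤ 3 * η := le_of_eq (by ring)
  have bound : ∀ {k x s : ℝ≥0∞}, x ≤ k * s → s ≤ 3 * η → k ≤ K₀ + K₁ + K₂ + K₃ + K₄ + K₅ →
      x ≤ K * η := by
    intro k x s h1 h2 h3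
    calc x ≤ k * s := h1
      _ ≤ (K₀ + K₁ + K₂ + K₃ + K₄ + K₅) * (3 * η) := by gcongr
      _ = K * η := by rw [hK]; ring
  refine ⟨W, ⟨n, f, fun i => regularize r (g i), hf, fun i => memD_regularize hr (hg i), rfl⟩, ?_⟩
  refine lt_of_le_of_lt (normWN_sub_le hu hWs (B := K * η) ?_ (fun i j => ?_) (fun i => ?_) ?_ ?_ ?_)
    (lt_of_le_of_lt (le_of_eq ?_) hηε)
  · refine bound (H₀ r hr _ _ _ s0 (cV []) (cW []) (hx [])) (hE0.trans hη1) ?_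
    simp only [add_assoc, le_self_add]
  · refine bound (H₁ r hr _ _ _ (s2 _ _) (cV _) (cW _) (hx [i, j])) ((hExx i j).trans hη1) ?_
    exact le_add_self.trans (le_self_add.trans (le_self_add.trans (le_self_add.trans le_self_add)))
  · refine bound (H₂ r hr _ _ _ (s1 _) (cV _) (cW _) (hx [i])) ((hEx i).trans hη1) ?_
    exact le_add_self.trans (le_self_add.trans (le_self_add.trans le_self_add))
  · refine bound (H₅ r hr u _ _ V _ _ _ s0 (s1 y) (s2 y y) (cV []) (cV _) (cV _) hmean hP hWyy')
      ((add_le_add (add_le_add hEyy hEy') hE0).trans hη3) le_add_self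
  · refine bound (H₃ r hr u _ V _ _ s0 (s1 y) (cV []) (cV _) hmean hP hWy')
      ((add_le_add hEy hE0).trans hη2) ?_
    exact le_add_self.trans (le_self_add.trans le_self_add)
  · refine bound (H₄ r hr u _ V _ _ s0 (s1 y) (cV []) (cV _) hmean hP hWy')
      ((add_le_add hEy' hE0).trans hη2) ?_
    exact le_add_self.trans le_self_add
  · ring

end Density

end AnisoSobolev

end

open AnisoSobolev in
theorem mainTheorem1 {𝕜 : Type*} [RCLike 𝕜] (N : ℕ) (p m α₁ α₂ : ℝ)
    (hp : 1 < p) (hα₂ : α₂ < 2) (hm : max (-α₁) 0 < (m + 1) / p) :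
    (∀ w ∈ tensorCcD N 𝕜, MemWN p α₁ α₂ m w) ∧
    ∀ u : Pt N → 𝕜, MemWN p α₁ α₂ m u → ∀ ε : ℝ, 0 < ε →
      ∃ w ∈ tensorCcD N 𝕜, normWN p α₁ α₂ m (u - w) < ENNReal.ofReal ε :=
  ⟨fun _ hw => memWN_of_mem_tensorCcD hp hm hw, fun _ hu _ hε =>
    exists_mem_tensorCcD_normWN_sub_lt hp hα₂ hm hu (ENNReal.ofReal_pos.2 hε)⟩
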